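/- **Setting.** Let $M$ be a smooth (Hausdorff) manifold of dimension $n+m$, $n,m\ge 1$, with an N-connection, i.e. a smooth splitting $TM=hM\oplus vM$ with $\operatorname{rank} hM=n$, $\operatorname{rank} vM=m$ (no integrability is required; $h,v$ also denote the projections), and a d-metric $\mathbf g$, i.e. a smooth pseudo-Riemannian metric with $hM\perp vM$. Let $\mathbf D$ be a smooth metric compatible d-connection, i.e. a covariant derivative on $TM$ that preserves the splitting and satisfies $\mathbf D\mathbf g=0$. Assume that its curvature has the constant matrix of $SO(n+1)/SO(n)$ on $hM$ and of $SO(m+1)/SO(m)$ on $vM$, scaled by constants $\overrightarrow R,\overleftarrow S\in\mathbb R$: for all vector fields $X,Y$ and sections $Z$ of $hM$, $W$ of $vM$, $$R(X,Y)Z=\overrightarrow R\,(\mathbf g(hY,Z)\,hX-\mathbf g(hX,Z)\,hY),\qquad R(X,Y)W=\overleftarrow S\,(\mathbf g(vY,W)\,vX-\mathbf g(vX,W)\,vY),$$ with $R(X,Y)=[\mathbf D_X,\mathbf D_Y]-\mathbf D_{[X,Y]}$. (So $\overrightarrow R=1$ for the unit sphere $SO(n+1)/SO(n)$; the full contraction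 of the horizontal curvature is $n(n-1)\overrightarrow R$.) Let $\gamma(\tau,\mathbf l)$, $\tau\in T\subset\mathbb R$ open, $\mathbf l\in\mathbb R$, be a smooth curve flow in $M$ on which the torsion $\mathbf T(\gamma_{\mathbf l},\gamma_\tau)$ vanishes, and which is non-stretching: $\mathbf g(h\gamma_{\mathbf l},h\gamma_{\mathbf l})=\mathbf g(v\gamma_{\mathbf l},v\gamma_{\mathbf l})=1$. Let $E_0=h\gamma_{\mathbf l},E_1,\dots,E_{n-1}$ be a smooth parallel orthonormal frame of $hM$ along $\gamma$: $\mathbf g(E_i,E_j)=0$ for $i\ne j$, $\mathbf g(E_i,E_i)=\varepsilon_i=\pm1$ for $i\geq 1$, and $\mathbf D_{\mathbf l}E_i$ is a multiple of $E_0$ for $i\ge1$. Define functions $\overrightarrow v,\overrightarrow\varpi,h\overrightarrow{\mathbf e}_\perp$ with values in $\mathbb R^{n-1}$, $h\mathbf e_\parallel$ with values in $\mathbb R$, and $h\Theta$ with values in the $(n-1)\times(n-1)$ matrices, by $$\mathbf D_{\mathbf l}E_0=-\sum_i v_iE_i,\quad \mathbf D_\tau E_0=-\sum_i\varpi_iE_i,\quad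 h\gamma_\tau=h\mathbf e_\parallel E_0+\sum_i(h\mathbf e_\perp)_iE_i,\quad \mathbf D_\tau E_i\equiv-\sum_j(h\Theta)_{ij}E_j \bmod E_0 .$$ Likewise define $\overleftarrow v,\overleftarrow\varpi,v\overleftarrow{\mathbf e}_\perp,v\mathbf e_\parallel,v\Theta$ from such a frame of $vM$ with first vector $v\gamma_{\mathbf l}$. Write $A\cdot B=\sum_i\varepsilon_iA_iB_i$, $(A\otimes B)_{ij}=\varepsilon_iA_iB_j$, $A\wedge B=A\otimes B-B\otimes A$, $(A\rfloor Q)_j=\sum_iA_iQ_{ij}$ and $D=\partial_{\mathbf l}$. **Operators.** For a choice $D^{-1}$ of antiderivatives, let $$h\mathcal J=D+D^{-1}(\overrightarrow v\,\cdot\,)\overrightarrow v,\qquad v\mathcal J=D+D^{-1}(\overleftarrow v\,\cdot\,)\overleftarrow v,$$ $$h\mathcal H=D+\overrightarrow v\rfloor D^{-1}(\overrightarrow v\wedge\,),\qquad v\mathcal H=D+\overleftarrow v\rfloor D^{-1}(\overleftarrow v\wedge\,).$$ **Lemma.** 1. (Structure equations.) For all $\tau\in T$, $\mathbf l\in\mathbb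 R$, $$0=Dh\mathbf e_\parallel+\overrightarrow v\cdot h\overrightarrow{\mathbf e}_\perp,\qquad 0=\overrightarrow\varpi-h\mathbf e_\parallel\overrightarrow v+Dh\overrightarrow{\mathbf e}_\perp,$$ $$D\overrightarrow\varpi-\overrightarrow v_\tau+\overrightarrow v\rfloor h\Theta=\overrightarrow R\,h\overrightarrow{\mathbf e}_\perp,\qquad Dh\Theta-\overrightarrow v\wedge\overrightarrow\varpi=0,$$ $\varepsilon_j(h\Theta)_{ij}=-\varepsilon_i(h\Theta)_{ji}$, and the same equations hold for the vertical functions, with $\overleftarrow S$. 2. (Flow equations.) For each $\tau\in T$ and any choice $D^{-1}$ of antiderivatives in $\mathbf l\in\mathbb R$ of $\overrightarrow v\cdot h\overrightarrow{\mathbf e}_\perp$ and of the entries of $\overrightarrow v\wedge\overrightarrow\varpi$, there are a constant $a$ and a constant matrix $A$ (independent of $\mathbf l$) with $h\mathbf e_\parallel=-D^{-1}(\overrightarrow v\cdot h\overrightarrow{\mathbf e}_\perp)+a$, $h\Theta=D^{-1}(\overrightarrow v\wedge\overrightarrow\varpi)+A$ and $$\overrightarrow\varpi=-h\mathcal J(h\overrightarrow{\mathbf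 e}_\perp)+a\overrightarrow v,\qquad \overrightarrow v_\tau=h\mathcal H(\overrightarrow\varpi)+\overrightarrow v\rfloor A-\overrightarrow R\,h\overrightarrow{\mathbf e}_\perp .$$ In particular, if the antiderivatives are those with $h\mathbf e_\parallel=-D^{-1}(\overrightarrow v\cdot h\overrightarrow{\mathbf e}_\perp)$ and $h\Theta=D^{-1}(\overrightarrow v\wedge\overrightarrow\varpi)$, then $$\overrightarrow\varpi=-h\mathcal J(h\overrightarrow{\mathbf e}_\perp),\qquad \overrightarrow v_\tau=h\mathcal H(\overrightarrow\varpi)-\overrightarrow R\,h\overrightarrow{\mathbf e}_\perp .$$ The same holds for the vertical functions with $v\mathcal J,v\mathcal H,\overleftarrow S$. 3. (Symplectic operators.) Let $D^{-1}f(\mathbf l)=\tfrac12\big(\int_{-\infty}^{\mathbf l}f-\int_{\mathbf l}^\infty f\big)$ and $\langle\alpha,w\rangle=\int_{\mathbb R}\alpha\cdot w\,d\mathbf l$. Then $\mathcal J=h\mathcal J$ and $\mathcal J=v\mathcal J$ are symplectic operators in the Hamiltonian variable $v=\overrightarrow v$, respectively $v=\overleftarrow v$: at every smooth $v$ and for all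 smooth compactly supported $a,b,c$, the function $\mathcal J_va$ is smooth, $\omega_v(a,b)=\langle a,\mathcal J_vb\rangle$ is skew-symmetric, and $\omega$ is closed: with $\partial_a\omega_v(b,c)=\frac{d}{ds}\big|_{s=0}\omega_{v+sa}(b,c)$ (these derivatives exist), $\partial_a\omega_v(b,c)+\partial_b\omega_v(c,a)+\partial_c\omega_v(a,b)=0$. 4. (Cosymplectic operators.) With the same $D^{-1}$, $\mathcal H=h\mathcal H$ and $\mathcal H=v\mathcal H$ are cosymplectic (Hamiltonian) operators: at every smooth $v$ and for all smooth compactly supported $\alpha,\beta$, the function $\mathcal H_v\alpha$ is smooth and $\langle\alpha,\mathcal H_v\beta\rangle=-\langle\beta,\mathcal H_v\alpha\rangle$. The Jacobi identity $$\frac{d}{ds}\Big|_{s=0}\Big(\langle\alpha,\mathcal H_{v+s\mathcal H_v\beta}\chi\rangle+\langle\beta,\mathcal H_{v+s\mathcal H_v\chi}\alpha\rangle+\langle\chi,\mathcal H_{v+s\mathcal H_v\alpha}\beta\rangle\Big)=0$$ (each of the three terms being differentiable at $s=0$) holds for all smooth compactly supported rotation invariant covectors $\alpha,\beta,\chi$,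 i.e. those with $\int v\wedge\alpha\,d\mathbf l=\int v\wedge\beta\,d\mathbf l=\int v\wedge\chi\,d\mathbf l=0$. -/

import Mathlib

open Bundle MeasureTheory
open scoped Manifold ContDiff

noncomputable section

/-! ## Geometry: N-connection, d-metric, d-connection -/

section Geometry

variable (E : Type*) [NormedAddCommGroup E] [NormedSpace ℝ E] [FiniteDimensional ℝ E]
  (M : Type*) [TopologicalSpace M] [ChartedSpace E M] [IsManifold 𝓘(ℝ, E) ∞ M]

/-- An N-connection on `M`: a smooth splitting `TM = hM ⊕ vM` with `vM` of rank `m`, given by the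
smooth field of projections of `TM` onto `vM` (the kernel is the horizontal distribution).
Neither distribution is required to be integrable. -/
structure NConnection (m : ℕ) where
  vproj : ∀ x : M, TangentSpace 𝓘(ℝ, E) x →L[ℝ] TangentSpace 𝓘(ℝ, E) x
  idem : ∀ (x : M) (ξ : TangentSpace 𝓘(ℝ, E) x), vproj x (vproj x ξ) = vproj x ξ
  rank_eq : ∀ x : M,
    Module.finrank ℝ (LinearMap.range (vproj x).toLinearMap) = m
  contMDiff : ContMDiff 𝓘(ℝ, E) (𝓘(ℝ, E).prod 𝓘(ℝ, E →L[ℝ] E)) ∞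
    (fun x ↦ TotalSpace.mk' (E →L[ℝ] E)
      (E := fun x : M ↦ TangentSpace 𝓘(ℝ, E) x →L[ℝ] TangentSpace 𝓘(ℝ, E) x) x (vproj x))

variable {E M}

/-- The projection of `TM` onto the horizontal distribution. -/
def NConnection.hproj {m : ℕ} (N : NConnection E M m) (x : M) :
    TangentSpace 𝓘(ℝ, E) x →L[ℝ] TangentSpace 𝓘(ℝ, E) x :=
  ContinuousLinearMap.id ℝ _ - N.vproj x

/-- A d-metric: a smooth pseudo-Riemannian metric (no signature is prescribed) for which the
horizontal and the vertical distribution are orthogonal. -/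
structure DMetric {m : ℕ} (N : NConnection E M m) where
  val : ∀ x : M, TangentSpace 𝓘(ℝ, E) x →L[ℝ] TangentSpace 𝓘(ℝ, E) x →L[ℝ] ℝ
  symm : ∀ (x : M) (ξ η : TangentSpace 𝓘(ℝ, E) x), val x ξ η = val x η ξ
  nondegenerate : ∀ (x : M) (ξ : TangentSpace 𝓘(ℝ, E) x), (∀ η, val x ξ η = 0) → ξ = 0
  contMDiff : ContMDiff 𝓘(ℝ, E) (𝓘(ℝ, E).prod 𝓘(ℝ, E →L[ℝ] E →L[ℝ] ℝ)) ∞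
    (fun x ↦ TotalSpace.mk' (E →L[ℝ] E →L[ℝ] ℝ)
      (E := fun x : M ↦ TangentSpace 𝓘(ℝ, E) x →L[ℝ] TangentSpace 𝓘(ℝ, E) x →L[ℝ] ℝ) x (val x))
  orthogonal : ∀ (x : M) (ξ η : TangentSpace 𝓘(ℝ, E) x), val x (N.hproj x ξ) (N.vproj x η) = 0

/-- A metric compatible d-connection: a smooth covariant derivative on `TM` which preserves the
splitting `TM = hM ⊕ vM` and for which the d-metric is parallel. (In Mathlib, `cov Z x ξ` is the
derivative of the field `Z` at `x` in the direction `ξ`.) -/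
structure DConnection {m : ℕ} {N : NConnection E M m} (g : DMetric N) where
  cov : CovariantDerivative 𝓘(ℝ, E) E (TangentSpace 𝓘(ℝ, E) : M → Type _)
  smooth : CovariantDerivative.ContMDiffCovariantDerivative cov ∞
  preserves : ∀ (x : M) (Z : ∀ y : M, TangentSpace 𝓘(ℝ, E) y), MDiffAt (T% Z) x →
    ∀ ξ : TangentSpace 𝓘(ℝ, E) x,
      cov (fun y ↦ N.vproj y (Z y)) x ξ = N.vproj x (cov Z x ξ)
  metric : ∀ (x : M) (Z W : ∀ y : M, TangentSpace 𝓘(ℝ, E) y), MDiffAt (T% Z) x →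
    MDiffAt (T% W) x → ∀ ξ : TangentSpace 𝓘(ℝ, E) x,
      mvfderiv 𝓘(ℝ, E) (fun y ↦ g.val y (Z y) (W y)) x ξ
        = g.val x (cov Z x ξ) (W x) + g.val x (Z x) (cov W x ξ)

/-- `R(X, Y) Z = D_X D_Y Z - D_Y D_X Z - D_[X, Y] Z` at the point `x`. -/
def curvatureAt (cov : CovariantDerivative 𝓘(ℝ, E) E (TangentSpace 𝓘(ℝ, E) : M → Type _))
    (X Y Z : ∀ y : M, TangentSpace 𝓘(ℝ, E) y) (x : M) : TangentSpace 𝓘(ℝ, E) x :=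
  cov (fun y ↦ cov Z y (Y y)) x (X x) - cov (fun y ↦ cov Z y (X y)) x (Y x)
    - cov Z x (VectorField.mlieBracket 𝓘(ℝ, E) X Y x)

/-- The curvature of the d-connection on the distribution `P TM` (`P` the horizontal or the
vertical projection) has, in every orthonormal frame of `P TM`, the constant matrix
`R(X, Y) = - κ [e_X, e_Y]` of the symmetric space `SO(k + 1) / SO(k)`, scaled by `κ`:
`R(X, Y) Z = κ (g(PY, Z) PX - g(PX, Z) PY)` for all sections `Z` of `P TM`. -/
def HasConstantCurvature {m : ℕ} {N : NConnection E M m} {g : DMetric N} (D : DConnection g)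
    (P : ∀ x : M, TangentSpace 𝓘(ℝ, E) x →L[ℝ] TangentSpace 𝓘(ℝ, E) x) (κ : ℝ) : Prop :=
  ∀ (x : M) (X Y Z : ∀ y : M, TangentSpace 𝓘(ℝ, E) y),
    CMDiffAt ∞ (T% X) x → CMDiffAt ∞ (T% Y) x → CMDiffAt ∞ (T% Z) x →
    (∀ y, P y (Z y) = Z y) →
    curvatureAt D.cov X Y Z x
      = κ • (g.val x (P x (Y x)) (Z x) • P x (X x) - g.val x (P x (X x)) (Z x) • P x (Y x))

/-! ## Curve flows and their parallel frames -/

/-- The covariant derivative, at the parameter `r` and in the direction `ξ` of the parameter plane,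
of a field `W` of tangent vectors along the map `γ`. Near `γ r` the bundle is trivialized;
coefficients of `W` are differentiated as functions of the parameters, and the frame of the
trivialization is differentiated with `cov` in the direction `dγ(ξ)`. -/
def covAlong (cov : CovariantDerivative 𝓘(ℝ, E) E (TangentSpace 𝓘(ℝ, E) : M → Type _))
    (γ : ℝ × ℝ → M) (W : ∀ r : ℝ × ℝ, TangentSpace 𝓘(ℝ, E) (γ r)) (r ξ : ℝ × ℝ) :
    TangentSpace 𝓘(ℝ, E) (γ r) :=
  let e := trivializationAt E (TangentSpace 𝓘(ℝ, E) : M → Type _) (γ r)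
  e.symm (γ r) (fderiv ℝ (fun s ↦ (e (TotalSpace.mk' E (γ s) (W s))).2) r ξ)
    + cov (fun x ↦ e.symm x (e (TotalSpace.mk' E (γ r) (W r))).2) (γ r)
        (mfderiv 𝓘(ℝ, ℝ × ℝ) 𝓘(ℝ, E) γ r ξ)

/-- The evolution vector `Y = γ_τ` of `γ (τ, l)`. -/
def flowVec (γ : ℝ × ℝ → M) (r : ℝ × ℝ) : TangentSpace 𝓘(ℝ, E) (γ r) :=
  mfderiv 𝓘(ℝ, ℝ × ℝ) 𝓘(ℝ, E) γ r ((1, 0) : ℝ × ℝ)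

/-- The tangent vector `X = γ_l` of `γ (τ, l)`. -/
def tangentVec (γ : ℝ × ℝ → M) (r : ℝ × ℝ) : TangentSpace 𝓘(ℝ, E) (γ r) :=
  mfderiv 𝓘(ℝ, ℝ × ℝ) 𝓘(ℝ, E) γ r ((0, 1) : ℝ × ℝ)

/-- A parallel orthonormal frame of `P TM` (`P` the horizontal or the vertical projection) along
the flow `γ (τ, l)`, `τ ∈ T`. Its first vector is `P γ_l`, which has norm one (the flow is
non-stretching); the other ones have norms `ε i = ± 1`, are normal to `P γ_l`, and have derivatives
along the curve that are tangent to `P γ_l`. -/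
structure ParallelFrame {m : ℕ} {N : NConnection E M m} {g : DMetric N} (D : DConnection g)
    (P : ∀ x : M, TangentSpace 𝓘(ℝ, E) x →L[ℝ] TangentSpace 𝓘(ℝ, E) x)
    (γ : ℝ × ℝ → M) (T : Set ℝ) {k : ℕ} (ε : Fin k → ℝ) where
  vec : Fin (k + 1) → ∀ r : ℝ × ℝ, TangentSpace 𝓘(ℝ, E) (γ r)
  contMDiffOn : ∀ i, ContMDiffOn 𝓘(ℝ, ℝ × ℝ) 𝓘(ℝ, E).tangent ∞
    (fun r ↦ (TotalSpace.mk' E (γ r) (vec i r) : TangentBundle 𝓘(ℝ, E) M)) (T ×ˢ Set.univ)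
  sign : ∀ i, ε i = 1 ∨ ε i = -1
  adapted : ∀ r ∈ T ×ˢ (Set.univ : Set ℝ), ∀ i, P (γ r) (vec i r) = vec i r
  tangent : ∀ r ∈ T ×ˢ (Set.univ : Set ℝ), vec 0 r = P (γ r) (tangentVec γ r)
  orthonormal : ∀ r ∈ T ×ˢ (Set.univ : Set ℝ), ∀ i j,
    g.val (γ r) (vec i r) (vec j r) = if i = j then (Fin.cons 1 ε : Fin (k + 1) → ℝ) i else 0
  parallel : ∀ r ∈ T ×ˢ (Set.univ : Set ℝ), ∀ i : Fin k, ∃ a : ℝ,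
    covAlong D.cov γ (vec i.succ) r (0, 1) = a • vec 0 r

/-- The component functions of a curve flow, as functions of `τ` and `l`. -/
structure FlowData (k : ℕ) where
  v : ℝ → ℝ → Fin k → ℝ
  ϖ : ℝ → ℝ → Fin k → ℝ
  ePar : ℝ → ℝ → ℝ
  ePerp : ℝ → ℝ → Fin k → ℝ
  Θ : ℝ → ℝ → Matrix (Fin k) (Fin k) ℝ

/-- The components of a flow in a parallel frame `E_0 = P γ_l, E_1, …, E_k`:
`D_l E_0 = - ∑ v_i E_i`, `D_τ E_0 = - ∑ ϖ_i E_i`, `P γ_τ = e_∥ E_0 + ∑ (e_⊥)_i E_i`, and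
`- Θ_ij` is the coefficient of `E_j` in `D_τ E_i`. The signs are those of the matrix connection
`D a = ∂ a + [Γ, a]`, with `Γ_X` and `Γ_Y` having the top rows `v` and `ϖ`. -/
def ParallelFrame.data {m : ℕ} {N : NConnection E M m} {g : DMetric N} {D : DConnection g}
    {P : ∀ x : M, TangentSpace 𝓘(ℝ, E) x →L[ℝ] TangentSpace 𝓘(ℝ, E) x}
    {γ : ℝ × ℝ → M} {T : Set ℝ} {k : ℕ} {ε : Fin k → ℝ}
    (F : ParallelFrame D P γ T ε) : FlowData k where
  v τ l i := -(ε i * g.val (γ (τ, l))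
    (covAlong D.cov γ (F.vec 0) (τ, l) (0, 1)) (F.vec i.succ (τ, l)))
  ϖ τ l i := -(ε i * g.val (γ (τ, l))
    (covAlong D.cov γ (F.vec 0) (τ, l) (1, 0)) (F.vec i.succ (τ, l)))
  ePar τ l := g.val (γ (τ, l)) (P (γ (τ, l)) (flowVec γ (τ, l))) (F.vec 0 (τ, l))
  ePerp τ l i := ε i * g.val (γ (τ, l)) (P (γ (τ, l)) (flowVec γ (τ, l))) (F.vec i.succ (τ, l))
  Θ τ l i j := -(ε j * g.val (γ (τ, l))
    (covAlong D.cov γ (F.vec i.succ) (τ, l) (1, 0)) (F.vec j.succ (τ, l)))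

end Geometry

/-! ## The operators -/

section Operators

variable {k : ℕ}

/-- `A · B`, for the (pseudo-)Euclidean metric `diag ε`. -/
def dotp (ε A B : Fin k → ℝ) : ℝ := ∑ i, ε i * A i * B i

/-- `A ⊗ B = Aᵀ B` (with `A` lowered by `diag ε`), so that `C ⌟ (A ⊗ B) = (C · A) B`; here
`C ⌟ Q` is the product `C ᵥ* Q` of a row vector and a matrix. -/
def outer (ε A B : Fin k → ℝ) : Matrix (Fin k) (Fin k) ℝ := Matrix.of fun i j ↦ ε i * A i * B j

/-- `A ∧ B = A ⊗ B - B ⊗ A`. -/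
def wedge (ε A B : Fin k → ℝ) : Matrix (Fin k) (Fin k) ℝ := outer ε A B - outer ε B A

/-- `Dinv f` is an antiderivative of `f`. -/
def IsAntiderivative (Dinv : (ℝ → ℝ) → ℝ → ℝ) (f : ℝ → ℝ) : Prop :=
  ∀ l, HasDerivAt (Dinv f) (f l) l

/-- `D⁻¹ (v ∧ w)`, entry by entry. -/
def wedgeInv (Dinv : (ℝ → ℝ) → ℝ → ℝ) (ε : Fin k → ℝ) (v w : ℝ → Fin k → ℝ) (l : ℝ) :
    Matrix (Fin k) (Fin k) ℝ :=
  Matrix.of fun i j ↦ Dinv (fun s ↦ wedge ε (v s) (w s) i j) l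

/-- `𝓙 = D + D⁻¹ (v ·) v`. -/
def opJ (Dinv : (ℝ → ℝ) → ℝ → ℝ) (ε : Fin k → ℝ) (v w : ℝ → Fin k → ℝ) : ℝ → Fin k → ℝ :=
  fun l ↦ deriv w l + Dinv (fun s ↦ dotp ε (v s) (w s)) l • v l

/-- `𝓗 = D + v ⌟ D⁻¹ (v ∧)`. -/
def opH (Dinv : (ℝ → ℝ) → ℝ → ℝ) (ε : Fin k → ℝ) (v w : ℝ → Fin k → ℝ) : ℝ → Fin k → ℝ :=
  fun l ↦ deriv w l + Matrix.vecMul (v l) (wedgeInv Dinv ε v w l)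

/-- The skew-adjoint antiderivative `½ (∫_{-∞}^l f - ∫_l^∞ f)`. -/
def skewInv (f : ℝ → ℝ) (l : ℝ) : ℝ :=
  ((∫ s in Set.Iic l, f s) - ∫ s in Set.Ioi l, f s) / 2

/-- Smooth compactly supported vector functions of `l`. -/
def IsTestField (w : ℝ → Fin k → ℝ) : Prop := ContDiff ℝ ∞ w ∧ HasCompactSupport w

/-- `⟨α, w⟩ = ∫ α · w dl`. -/
def pairing (ε : Fin k → ℝ) (α w : ℝ → Fin k → ℝ) : ℝ := ∫ l, dotp ε (α l) (w l)

/-- A family `J_v` of operators from vectors to covectors, depending on the Hamiltonian variable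
`v`, is symplectic: `ω_v(a, b) = ⟨a, J_v b⟩` is a skew-symmetric and closed two-form, that is
`∂_a ω(b, c) + ∂_b ω(c, a) + ∂_c ω(a, b) = 0`. -/
def IsSymplecticOperator (ε : Fin k → ℝ)
    (J : (ℝ → Fin k → ℝ) → (ℝ → Fin k → ℝ) → ℝ → Fin k → ℝ) : Prop :=
  ∀ v, ContDiff ℝ ∞ v →
    (∀ a, IsTestField a → ContDiff ℝ ∞ (J v a)) ∧
    (∀ a b, IsTestField a → IsTestField b →
      pairing ε a (J v b) = -pairing ε b (J v a)) ∧
    (∀ a b c, IsTestField a → IsTestField b → IsTestField c →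
      ∃ d₁ d₂ d₃ : ℝ,
        HasDerivAt (fun s : ℝ ↦ pairing ε b (J (v + s • a) c)) d₁ 0 ∧
        HasDerivAt (fun s : ℝ ↦ pairing ε c (J (v + s • b) a)) d₂ 0 ∧
        HasDerivAt (fun s : ℝ ↦ pairing ε a (J (v + s • c) b)) d₃ 0 ∧
        d₁ + d₂ + d₃ = 0)

/-- The covectors at `v` that annihilate the infinitesimal rotations of `v`, that is the covectors
of the space of rotation classes: `∫ v ∧ α dl = 0`. -/
def IsInvariantCovector (ε : Fin k → ℝ) (v α : ℝ → Fin k → ℝ) : Prop :=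
  IsTestField α ∧ ∀ i j, ∫ l, wedge ε (v l) (α l) i j = 0

/-- A family `H_v` of operators from covectors to vectors, depending on the Hamiltonian variable
`v`, is cosymplectic (a Hamiltonian operator): `π_v(α, β) = ⟨α, H_v β⟩` is skew-symmetric, and its
Schouten bracket with itself vanishes (the Jacobi identity) on rotation invariant covectors. -/
def IsCosymplecticOperator (ε : Fin k → ℝ)
    (H : (ℝ → Fin k → ℝ) → (ℝ → Fin k → ℝ) → ℝ → Fin k → ℝ) : Prop :=
  ∀ v, ContDiff ℝ ∞ v →
    (∀ α, IsTestField α → ContDiff ℝ ∞ (H v α)) ∧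
    (∀ α β, IsTestField α → IsTestField β →
      pairing ε α (H v β) = -pairing ε β (H v α)) ∧
    (∀ α β χ, IsInvariantCovector ε v α → IsInvariantCovector ε v β →
      IsInvariantCovector ε v χ →
      ∃ d₁ d₂ d₃ : ℝ,
        HasDerivAt (fun s : ℝ ↦ pairing ε α (H (v + s • H v β) χ)) d₁ 0 ∧
        HasDerivAt (fun s : ℝ ↦ pairing ε β (H (v + s • H v χ) α)) d₂ 0 ∧
        HasDerivAt (fun s : ℝ ↦ pairing ε χ (H (v + s • H v α) β)) d₃ 0 ∧
        d₁ + d₂ + d₃ = 0)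

/-! ## The equations of the flow -/

/-- The torsion and curvature structure equations of a flow, in components. -/
def SatisfiesStructureEqs (T : Set ℝ) (ε : Fin k → ℝ) (κ : ℝ) (f : FlowData k) : Prop :=
  ∀ τ ∈ T, ∀ l : ℝ,
    HasDerivAt (f.ePar τ) (-dotp ε (f.v τ l) (f.ePerp τ l)) l ∧
    HasDerivAt (f.ePerp τ) (f.ePar τ l • f.v τ l - f.ϖ τ l) l ∧
    (∃ ϖ' : Fin k → ℝ, HasDerivAt (f.ϖ τ) ϖ' l ∧
      HasDerivAt (fun t ↦ f.v t l)
        (ϖ' + Matrix.vecMul (f.v τ l) (f.Θ τ l) - κ • f.ePerp τ l) τ) ∧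
    (∀ i j, HasDerivAt (fun s ↦ f.Θ τ s i j) (wedge ε (f.v τ l) (f.ϖ τ l) i j) l) ∧
    (∀ i j, ε j * f.Θ τ l i j = -(ε i * f.Θ τ l j i))

/-- The flow equations, expressed through `𝓙` and `𝓗` for an arbitrary choice `Dinv` of the
antiderivatives of `v · e_⊥` and `v ∧ ϖ`. The first part is general, with the integration constants
`a` and `A`; the second is for the choice for which these constants vanish. -/
def SatisfiesFlowEqs (T : Set ℝ) (ε : Fin k → ℝ) (κ : ℝ) (f : FlowData k) : Prop :=
  ∀ τ ∈ T, ∀ Dinv : (ℝ → ℝ) → ℝ → ℝ,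
    IsAntiderivative Dinv (fun l ↦ dotp ε (f.v τ l) (f.ePerp τ l)) →
    (∀ i j, IsAntiderivative Dinv (fun l ↦ wedge ε (f.v τ l) (f.ϖ τ l) i j)) →
    (∃ (a : ℝ) (A : Matrix (Fin k) (Fin k) ℝ), ∀ l : ℝ,
      f.ePar τ l = -Dinv (fun s ↦ dotp ε (f.v τ s) (f.ePerp τ s)) l + a ∧
      f.Θ τ l = wedgeInv Dinv ε (f.v τ) (f.ϖ τ) l + A ∧
      f.ϖ τ l = -opJ Dinv ε (f.v τ) (f.ePerp τ) l + a • f.v τ l ∧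
      HasDerivAt (fun t ↦ f.v t l)
        (opH Dinv ε (f.v τ) (f.ϖ τ) l + Matrix.vecMul (f.v τ l) A - κ • f.ePerp τ l) τ) ∧
    ((∀ l, f.ePar τ l = -Dinv (fun s ↦ dotp ε (f.v τ s) (f.ePerp τ s)) l) →
      (∀ l, f.Θ τ l = wedgeInv Dinv ε (f.v τ) (f.ϖ τ) l) →
      ∀ l : ℝ,
        f.ϖ τ l = -opJ Dinv ε (f.v τ) (f.ePerp τ) l ∧
        HasDerivAt (fun t ↦ f.v t l)
          (opH Dinv ε (f.v τ) (f.ϖ τ) l - κ • f.ePerp τ l) τ)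

end Operators

end

/-!
The theorem has two independent halves, one geometric and one analytic.

*Geometry.* Horizontal and vertical distributions are treated at once, as the range of a smooth
field `P` of projections that is parallel (`IsParallelProjection`). Near each parameter a field
along `γ` is a combination of globally smooth vector fields that are coordinate fields near the base
point, and `covAlong` obeys the Leibniz and chain rules for such combinations
(`covAlong_eq_sum`). As coordinate fields commute, this gives the three facts that are needed: the
metric is parallel along `γ` (`fderiv_metric`), the defect of symmetry of `D dγ` is the torsion
(`covAlong_mfderiv_sub`), and second derivatives along `γ` commute up to the curvature
(`covAlong_commutator`). Pairing `D_l (P γ_τ) = D_τ (P γ_l)` and `[D_l, D_τ] E_i = R (γ_l, γ_τ) E_i`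
with the frame, which spans `P TM` by a count of dimensions, gives the structure equations
(`ParallelFrame.satisfiesStructureEqs`). The flow equations follow, because two antiderivatives of
one function on the line differ by a constant.

*Analysis.* The bilinear form `(f, g) ↦ ∫ f D⁻¹ g` is skew on continuous functions of compact
support (`IsCc.skewForm_swap`). The two-form of `𝓙` and the bivector of `𝓗` are `∫ a · b'` plus
values of this form at functions that are linear in `v`; they are therefore quadratic polynomials
along affine lines of `v`, which gives the derivatives. For `𝓙` the cyclic sum cancels by skewness
alone. For `𝓗` the covectors are rotation invariant, so that the matrices `D⁻¹ (v αᵀ - α vᵀ)` have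
compact support; the cyclic sum is then the integral of the derivative of an explicit compactly
supported function (`hasDerivAt_jacobiPotential`), which vanishes.
-/

open scoped Topology

set_option linter.unusedSectionVars false

noncomputable section

/-! ### Frames of constant components and the covariant derivative in a trivialization -/

section Geometry

variable {E : Type*} [NormedAddCommGroup E] [NormedSpace ℝ E] [FiniteDimensional ℝ E]
  {M : Type*} [TopologicalSpace M] [ChartedSpace E M] [IsManifold 𝓘(ℝ, E) ∞ M]

/-- The preferred trivialization of the tangent bundle at `x₀`. -/
abbrev tangentTriv (E : Type*) [NormedAddCommGroup E] [NormedSpace ℝ E] [FiniteDimensional ℝ E]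
    {M : Type*} [TopologicalSpace M] [ChartedSpace E M] [IsManifold 𝓘(ℝ, E) ∞ M] (x₀ : M) :
    Trivialization E (TotalSpace.proj : TangentBundle 𝓘(ℝ, E) M → M) :=
  trivializationAt E (TangentSpace 𝓘(ℝ, E) : M → Type _) x₀

/-- The vector field whose components in the trivialization at `x₀` are constant, that is the field
with constant components in the chart at `x₀` (with junk values outside of the chart). -/
def constField (x₀ : M) (w : E) : ∀ x : M, TangentSpace 𝓘(ℝ, E) x :=
  fun x ↦ (tangentTriv E x₀).symm x w

/-- The components of a tangent vector at `x` in the trivialization at `x₀`. -/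
def triCoord (x₀ x : M) (ξ : TangentSpace 𝓘(ℝ, E) x) : E :=
  (tangentTriv E x₀ (TotalSpace.mk' E x ξ)).2

theorem mem_tangentTriv_baseSet {x₀ x : M} :
    x ∈ (tangentTriv E x₀).baseSet ↔ x ∈ (chartAt E x₀).source := by
  simp [tangentTriv]

theorem constField_eq_symmL {x₀ x : M} (hx : x ∈ (chartAt E x₀).source) (w : E) :
    constField x₀ w x = (tangentTriv E x₀).symmL ℝ x w :=
  (Trivialization.symmL_apply _ (mem_tangentTriv_baseSet.2 hx) w).symm

theorem triCoord_eq_continuousLinearMapAt {x₀ x : M} (hx : x ∈ (chartAt E x₀).source)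
    (ξ : TangentSpace 𝓘(ℝ, E) x) :
    triCoord x₀ x ξ = (tangentTriv E x₀).continuousLinearMapAt ℝ x ξ := by
  rw [Trivialization.continuousLinearMapAt_apply, Trivialization.linearMapAt_def_of_mem]
  · rfl
  · exact mem_tangentTriv_baseSet.2 hx

theorem triCoord_constField {x₀ x : M} (hx : x ∈ (chartAt E x₀).source) (w : E) :
    triCoord x₀ x (constField x₀ w x) = w := by
  rw [triCoord_eq_continuousLinearMapAt hx, constField_eq_symmL hx]
  exact Trivialization.continuousLinearMapAt_symmL _ (mem_tangentTriv_baseSet.2 hx) w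

theorem constField_triCoord {x₀ x : M} (hx : x ∈ (chartAt E x₀).source)
    (ξ : TangentSpace 𝓘(ℝ, E) x) : constField x₀ (triCoord x₀ x ξ) x = ξ := by
  rw [triCoord_eq_continuousLinearMapAt hx, constField_eq_symmL hx]
  exact Trivialization.symmL_continuousLinearMapAt _ (mem_tangentTriv_baseSet.2 hx) ξ

theorem contMDiffOn_constField (x₀ : M) (w : E) :
    CMDiff[(chartAt E x₀).source] ∞ (T% (constField x₀ w)) := by
  refine ((tangentTriv E x₀).contMDiffOn_section_iff (IB := 𝓘(ℝ, E)) (chartAt E x₀).open_source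
    (fun x hx ↦ mem_tangentTriv_baseSet.2 hx)).2 ?_
  exact (contMDiffOn_const (c := w)).congr fun x hx ↦ triCoord_constField hx w

theorem mdifferentiableAt_constField {x₀ x : M} (hx : x ∈ (chartAt E x₀).source) (w : E) :
    MDiffAt (T% (constField x₀ w)) x :=
  (((contMDiffOn_constField x₀ w) x hx).contMDiffAt
    ((chartAt E x₀).open_source.mem_nhds hx)).mdifferentiableAt (by simp)

theorem constField_sum_repr {ι : Type*} [Fintype ι] (b : Module.Basis ι ℝ E) {x₀ x : M}
    (hx : x ∈ (chartAt E x₀).source) (w : E) :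
    constField x₀ w x = ∑ i, b.repr w i • constField x₀ (b i) x := by
  conv_lhs => rw [← b.sum_repr w]
  simp only [constField_eq_symmL hx, map_sum, map_smul]

section Cov

variable (cov : CovariantDerivative 𝓘(ℝ, E) E (TangentSpace 𝓘(ℝ, E) : M → Type _))

theorem cov_sum {ι : Type*} (s : Finset ι) (f : ι → M → ℝ)
    (Z : ι → ∀ x : M, TangentSpace 𝓘(ℝ, E) x) {x : M}
    (hf : ∀ i ∈ s, MDiffAt (f i) x) (hZ : ∀ i ∈ s, MDiffAt (T% (Z i)) x) :
    cov (fun y ↦ ∑ i ∈ s, f i y • Z i y) x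
      = ∑ i ∈ s, (f i x • cov (Z i) x + (d% (f i) x).smulRight (Z i x)) := by
  classical
  induction s using Finset.induction_on with
  | empty =>
    simp only [Finset.sum_empty]
    exact congrFun cov.zero x
  | insert a s ha ih =>
    have h1 := hf a (Finset.mem_insert_self ..)
    have h2 := hZ a (Finset.mem_insert_self ..)
    have hf' := fun i hi ↦ hf i (Finset.mem_insert_of_mem hi)
    have hZ' := fun i hi ↦ hZ i (Finset.mem_insert_of_mem hi)
    simp only [Finset.sum_insert ha]
    rw [← ih hf' hZ', ← cov.isCovariantDerivativeOnUniv.leibniz h2 h1]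
    exact cov.isCovariantDerivativeOnUniv.add (h1.smul_section h2)
      (MDifferentiableAt.sum_section fun i hi ↦ (hf' i hi).smul_section (hZ' i hi))

theorem cov_congr {Z Z' : ∀ x : M, TangentSpace 𝓘(ℝ, E) x} {x : M} (hZ' : MDiffAt (T% Z') x)
    (h : ∀ᶠ y in 𝓝 x, Z y = Z' y) : cov Z x = cov Z' x := by
  refine cov.isCovariantDerivativeOnUniv.congr_of_eventuallyEq ?_ hZ' Filter.univ_mem h
  exact hZ'.congr_of_eventuallyEq (h.mono fun y hy ↦ by simp [hy])

theorem mdifferentiableAt_triCoord {Z : ∀ x : M, TangentSpace 𝓘(ℝ, E) x} {x : M}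
    (hZ : MDiffAt (T% Z) x) : MDiffAt (fun y ↦ triCoord x y (Z y)) x :=
  (mdifferentiableAt_section 𝓘(ℝ, E) Z).1 hZ

/-- The covariant derivative in a trivialization: differentiate the components, and the frame. -/
theorem cov_eq_triCoord {Z : ∀ x : M, TangentSpace 𝓘(ℝ, E) x} {x : M} (hZ : MDiffAt (T% Z) x)
    (η : TangentSpace 𝓘(ℝ, E) x) :
    cov Z x η = constField x ((d% (fun y ↦ triCoord x y (Z y)) x) η) x
      + cov (constField x (triCoord x x (Z x))) x η := by
  have hx : x ∈ (chartAt E x).source := mem_chart_source E x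
  let b := Module.finBasis ℝ E
  have hz := mdifferentiableAt_triCoord hZ
  set z : M → E := fun y ↦ triCoord x y (Z y) with hzdef
  let L : ∀ i, E →L[ℝ] ℝ := fun i ↦ LinearMap.toContinuousLinearMap (b.coord i)
  have hL : ∀ i w, b.repr w i = L i w := fun i w ↦ rfl
  have hLz : ∀ i, HasMFDerivAt 𝓘(ℝ, E) 𝓘(ℝ, ℝ) (fun y ↦ L i (z y)) x
      ((L i).comp (mfderiv 𝓘(ℝ, E) 𝓘(ℝ, E) z x)) := fun i ↦
    ((L i).hasMFDerivAt (x := z x)).comp x hz.hasMFDerivAt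
  have hc : ∀ i, MDiffAt (T% (constField x (b i))) x :=
    fun i ↦ mdifferentiableAt_constField hx (b i)
  -- Leibniz rule for `Z = ∑ i, z i • constField x (b i)`, which holds near `x`
  have h1 : cov Z x = ∑ i, (L i (z x) • cov (constField x (b i)) x
      + (d% (fun y ↦ L i (z y)) x).smulRight (constField x (b i) x)) := by
    rw [← cov_sum cov Finset.univ (fun i y ↦ L i (z y)) (fun i ↦ constField x (b i))
      (fun i _ ↦ (hLz i).mdifferentiableAt) (fun i _ ↦ hc i)]
    refine cov_congr cov (MDifferentiableAt.sum_section fun i _ ↦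
      (hLz i).mdifferentiableAt.smul_section (hc i)) ?_
    filter_upwards [(chartAt E x).open_source.mem_nhds hx] with y hy
    simp only [← hL, hzdef]
    rw [← constField_sum_repr b hy, constField_triCoord hy]
  have h2 : cov (constField x (z x)) x = ∑ i, L i (z x) • cov (constField x (b i)) x := by
    have : cov (fun y ↦ ∑ i, (fun _ : M ↦ L i (z x)) y • constField x (b i) y) x = _ :=
      cov_sum cov Finset.univ (fun i _ ↦ L i (z x)) (fun i ↦ constField x (b i))
      (fun i _ ↦ mdifferentiableAt_const) (fun i _ ↦ hc i)
    rw [cov_congr cov (Z' := fun y ↦ ∑ i, (fun _ : M ↦ L i (z x)) y • constField x (b i) y)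
      (MDifferentiableAt.sum_section fun i _ ↦
        MDifferentiableAt.smul_section mdifferentiableAt_const (hc i)) ?_, this]
    swap
    · filter_upwards [(chartAt E x).open_source.mem_nhds hx] with y hy
      exact constField_sum_repr b hy _
    refine Finset.sum_congr rfl fun i _ ↦ ?_
    simp [mvfderiv, mfderiv_const]
  rw [h1, h2, Finset.sum_add_distrib, add_comm]
  rw [constField_sum_repr b hx]
  simp only [add_apply, sum_apply, hL]
  congr 1
  refine Finset.sum_congr rfl fun i _ ↦ ?_
  simp only [ContinuousLinearMap.smulRight_apply]
  congr 1
  simp only [mvfderiv, (hLz i).mfderiv]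
  rfl

end Cov
end Geometry

/-! ### The covariant derivative along a map, and coordinate fields -/

section Geometry

variable {E : Type*} [NormedAddCommGroup E] [NormedSpace ℝ E] [FiniteDimensional ℝ E]
  {M : Type*} [TopologicalSpace M] [ChartedSpace E M] [IsManifold 𝓘(ℝ, E) ∞ M]

theorem triCoord_sum_smul {ι : Type*} [Fintype ι] {x₀ x : M} (hx : x ∈ (chartAt E x₀).source)
    (f : ι → ℝ) (ξ : ι → TangentSpace 𝓘(ℝ, E) x) :
    triCoord x₀ x (∑ i, f i • ξ i) = ∑ i, f i • triCoord x₀ x (ξ i) := by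
  simp only [triCoord_eq_continuousLinearMapAt hx, map_sum, map_smul]

/-- A field along a map which is a combination of restrictions of vector fields is differentiated
by the Leibniz and the chain rule; in particular `covAlong` does not depend on trivializations. -/
theorem covAlong_eq_sum (cov : CovariantDerivative 𝓘(ℝ, E) E (TangentSpace 𝓘(ℝ, E) : M → Type _))
    {ι : Type*} [Fintype ι] {γ : ℝ × ℝ → M} {W : ∀ r : ℝ × ℝ, TangentSpace 𝓘(ℝ, E) (γ r)}
    {r : ℝ × ℝ} (hγ : MDifferentiableAt 𝓘(ℝ, ℝ × ℝ) 𝓘(ℝ, E) γ r)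
    {f : ι → ℝ × ℝ → ℝ} {Z : ι → ∀ x : M, TangentSpace 𝓘(ℝ, E) x}
    (hf : ∀ i, DifferentiableAt ℝ (f i) r) (hZ : ∀ i, MDiffAt (T% (Z i)) (γ r))
    (hW : ∀ᶠ s in 𝓝 r, W s = ∑ i, f i s • Z i (γ s)) (ξ : ℝ × ℝ) :
    covAlong cov γ W r ξ = ∑ i, (fderiv ℝ (f i) r ξ • Z i (γ r)
      + f i r • cov (Z i) (γ r) (mfderiv 𝓘(ℝ, ℝ × ℝ) 𝓘(ℝ, E) γ r ξ)) := by
  set x₀ := γ r with hx₀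
  have hx : x₀ ∈ (chartAt E x₀).source := mem_chart_source E x₀
  have hnear : ∀ᶠ s in 𝓝 r, γ s ∈ (chartAt E x₀).source :=
    hγ.continuousAt.eventually ((chartAt E x₀).open_source.mem_nhds hx)
  have hz : ∀ i, MDiffAt (fun y ↦ triCoord x₀ y (Z i y)) x₀ :=
    fun i ↦ mdifferentiableAt_triCoord (hZ i)
  let dγ : ℝ × ℝ →L[ℝ] E := mfderiv 𝓘(ℝ, ℝ × ℝ) 𝓘(ℝ, E) γ r
  let dz : ι → E →L[ℝ] E := fun i ↦ d% (fun y ↦ triCoord x₀ y (Z i y)) x₀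
  have hz' : ∀ i, HasFDerivAt (fun s ↦ triCoord x₀ (γ s) (Z i (γ s))) ((dz i).comp dγ) r :=
      fun i ↦ by
    have := (hz i).hasMFDerivAt.comp r hγ.hasMFDerivAt
    exact this.hasFDerivAt
  -- derivative of the components of `W`: Leibniz rule in `f i`, chain rule in `Z i ∘ γ`
  have hd : HasFDerivAt (fun s ↦ triCoord x₀ (γ s) (W s)) (∑ i,
      (f i r • (dz i).comp dγ +
        (fderiv ℝ (f i) r).smulRight (triCoord x₀ x₀ (Z i x₀)))) r := by
    refine (HasFDerivAt.fun_sum fun i _ ↦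
      (hf i).hasFDerivAt.smul (hz' i)).congr_of_eventuallyEq ?_
    filter_upwards [hnear, hW] with s hs hWs
    rw [hWs, triCoord_sum_smul hs]
    rfl
  have key : covAlong cov γ W r ξ
      = constField x₀ (fderiv ℝ (fun s ↦ triCoord x₀ (γ s) (W s)) r ξ) x₀
        + cov (constField x₀ (triCoord x₀ x₀ (W r))) x₀
            (mfderiv 𝓘(ℝ, ℝ × ℝ) 𝓘(ℝ, E) γ r ξ) := rfl
  -- derivative of the frame of the trivialization, linear in the components of `W r`
  have hc : cov (constField x₀ (triCoord x₀ x₀ (W r))) x₀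
      = ∑ i, f i r • cov (constField x₀ (triCoord x₀ x₀ (Z i x₀))) x₀ := by
    have hcd := fun i ↦ mdifferentiableAt_constField hx (triCoord x₀ x₀ (Z i x₀))
    have h := cov_sum cov Finset.univ (fun i _ ↦ f i r)
      (fun i ↦ constField x₀ (triCoord x₀ x₀ (Z i x₀))) (x := x₀)
      (fun i _ ↦ mdifferentiableAt_const) (fun i _ ↦ hcd i)
    rw [cov_congr cov (MDifferentiableAt.sum_section fun i _ ↦
        MDifferentiableAt.smul_section (mdifferentiableAt_const (c := f i r)) (hcd i)) ?_]
    · refine h.trans (Finset.sum_congr rfl fun i _ ↦ ?_)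
      simp [mvfderiv, mfderiv_const]
    · filter_upwards [(chartAt E x₀).open_source.mem_nhds hx] with y hy
      rw [hW.self_of_nhds, triCoord_sum_smul hx]
      change _ = ∑ i, f i r • constField x₀ (triCoord x₀ x₀ (Z i x₀)) y
      simp only [constField_eq_symmL hy, map_sum, map_smul]
      rfl
  rw [key, hd.fderiv, hc]
  simp only [constField_eq_symmL hx, map_sum, map_smul, sum_apply, add_apply, smul_apply,
    ContinuousLinearMap.smulRight_apply, map_add, ContinuousLinearMap.comp_apply]
  simp only [← constField_eq_symmL hx, constField_triCoord hx]
  rw [← Finset.sum_add_distrib]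
  refine Finset.sum_congr rfl fun i _ ↦ ?_
  rw [cov_eq_triCoord cov (hZ i)]
  simp only [smul_add]
  exact (by intros; abel : ∀ a b c : TangentSpace 𝓘(ℝ, E) x₀, a + b + c = b + (a + c)) _ _ _

end Geometry

section Frame

variable {E : Type*} [NormedAddCommGroup E] [NormedSpace ℝ E] [FiniteDimensional ℝ E]
  {M : Type*} [TopologicalSpace M] [T2Space M] [ChartedSpace E M] [IsManifold 𝓘(ℝ, E) ∞ M]

/-- Smooth vector fields on all of `M` which are coordinate fields near `x₀`: the coordinate fields
of the chart at `x₀`, cut off by a bump function. -/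
def coordField (x₀ : M) (i : Fin (Module.finrank ℝ E)) : ∀ x : M, TangentSpace 𝓘(ℝ, E) x :=
  (Classical.arbitrary (SmoothBumpFunction 𝓘(ℝ, E) x₀) : M → ℝ) •
    constField x₀ (Module.finBasis ℝ E i)

theorem contMDiff_coordField (x₀ : M) (i : Fin (Module.finrank ℝ E)) :
    CMDiff ∞ (T% (coordField x₀ i)) :=
  ContMDiffOn.smul_section_of_tsupport
    (Classical.arbitrary (SmoothBumpFunction 𝓘(ℝ, E) x₀)).contMDiff.contMDiffOn
    (chartAt E x₀).open_source
    (SmoothBumpFunction.tsupport_subset_chartAt_source _) (contMDiffOn_constField x₀ _)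

theorem mdifferentiableAt_coordField (x₀ : M) (i : Fin (Module.finrank ℝ E)) (x : M) :
    MDiffAt (T% (coordField x₀ i)) x :=
  ((contMDiff_coordField x₀ i) x).mdifferentiableAt (by simp)

theorem coordField_eventuallyEq (x₀ : M) :
    ∀ᶠ x in 𝓝 x₀, ∀ i : Fin (Module.finrank ℝ E),
      coordField x₀ i x = constField x₀ (Module.finBasis ℝ E i) x := by
  filter_upwards [(Classical.arbitrary (SmoothBumpFunction 𝓘(ℝ, E) x₀)).eventuallyEq_one]
    with x hx i
  simp [coordField, hx]

/-- Near `x₀` the fields are the coordinate fields of a chart, hence commute. -/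
theorem mlieBracket_coordField (x₀ : M) (i j : Fin (Module.finrank ℝ E)) :
    VectorField.mlieBracket 𝓘(ℝ, E) (coordField x₀ i) (coordField x₀ j) x₀ = 0 := by
  -- in the chart both fields are constant near the image of `x₀`
  have key : ∀ i : Fin (Module.finrank ℝ E), VectorField.mpullbackWithin 𝓘(ℝ, E) 𝓘(ℝ, E)
      (extChartAt 𝓘(ℝ, E) x₀).symm (coordField x₀ i) (Set.range 𝓘(ℝ, E))
      =ᶠ[𝓝 (extChartAt 𝓘(ℝ, E) x₀ x₀)] fun _ ↦ Module.finBasis ℝ E i := by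
    intro i
    have h1 : ContinuousAt (extChartAt 𝓘(ℝ, E) x₀).symm (extChartAt 𝓘(ℝ, E) x₀ x₀) :=
      continuousAt_extChartAt_symm x₀
    have h2 : ∀ᶠ x in 𝓝 ((extChartAt 𝓘(ℝ, E) x₀).symm (extChartAt 𝓘(ℝ, E) x₀ x₀)),
        ∀ i : Fin (Module.finrank ℝ E),
          coordField x₀ i x = constField x₀ (Module.finBasis ℝ E i) x := by
      rw [extChartAt_to_inv]
      exact coordField_eventuallyEq x₀
    have h2 := h1.eventually h2
    filter_upwards [h2, extChartAt_target_mem_nhds (I := 𝓘(ℝ, E)) x₀] with y hy hyt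
    have hys : (extChartAt 𝓘(ℝ, E) x₀).symm y ∈ (chartAt E x₀).source := by
      simpa using (extChartAt 𝓘(ℝ, E) x₀).map_target hyt
    rw [VectorField.mpullbackWithin_apply, hy i, constField_eq_symmL hys,
      TangentBundle.symmL_trivializationAt hys, (extChartAt 𝓘(ℝ, E) x₀).right_inv hyt]
    exact (isInvertible_mfderivWithin_extChartAt_symm hyt).inverse_apply_self _
  rw [← VectorField.mlieBracketWithin_univ, VectorField.mlieBracketWithin_apply]
  have aux : ∀ (V W : E → E) (v w z : E) (s : Set E), (V =ᶠ[𝓝 z] fun _ ↦ v) →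
      (W =ᶠ[𝓝 z] fun _ ↦ w) → VectorField.lieBracketWithin ℝ V W s z = 0 := by
    intro V W v w z s hV hW
    simp [VectorField.lieBracketWithin, hV.fderivWithin_eq_of_nhds, hW.fderivWithin_eq_of_nhds]
  exact (congrArg _ (aux _ _ _ _ _ _ (key i) (key j))).trans (map_zero _)

/-- A field `W` of tangent vectors along `γ` is smooth at the parameter `r`. -/
def SmoothAlong (γ : ℝ × ℝ → M) (W : ∀ r : ℝ × ℝ, TangentSpace 𝓘(ℝ, E) (γ r)) (r : ℝ × ℝ) : Prop :=
  ContMDiffAt 𝓘(ℝ, ℝ × ℝ) 𝓘(ℝ, E).tangent ∞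
    (fun s ↦ (TotalSpace.mk' E (γ s) (W s) : TangentBundle 𝓘(ℝ, E) M)) r

variable {γ : ℝ × ℝ → M} {W : ∀ r : ℝ × ℝ, TangentSpace 𝓘(ℝ, E) (γ r)} {r : ℝ × ℝ}

theorem SmoothAlong.contMDiffAt (hW : SmoothAlong γ W r) :
    ContMDiffAt 𝓘(ℝ, ℝ × ℝ) 𝓘(ℝ, E) ∞ γ r :=
  (contMDiffAt_totalSpace.1 hW).1

/-- A smooth field along `γ` is, locally, a combination of coordinate fields, with smooth
coefficients. -/
theorem SmoothAlong.exists_coeff (hW : SmoothAlong γ W r) :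
    ∃ f : Fin (Module.finrank ℝ E) → ℝ × ℝ → ℝ, (∀ i, ContDiffAt ℝ ∞ (f i) r) ∧
      ∀ᶠ s in 𝓝 r, W s = ∑ i, f i s • coordField (γ r) i (γ s) := by
  obtain ⟨hγ, hW⟩ := contMDiffAt_totalSpace.1 hW
  have hW : ContDiffAt ℝ ∞ (fun s ↦ triCoord (γ r) (γ s) (W s)) r := hW.contDiffAt
  let b := Module.finBasis ℝ E
  refine ⟨fun i s ↦ LinearMap.toContinuousLinearMap (b.coord i) (triCoord (γ r) (γ s) (W s)),
    fun i ↦ (ContinuousLinearMap.contDiff _).contDiffAt.comp r hW, ?_⟩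
  filter_upwards [hγ.continuousAt.eventually (coordField_eventuallyEq (E := E) (γ r)),
    hγ.continuousAt.eventually ((chartAt E (γ r)).open_source.mem_nhds (mem_chart_source E _))]
    with s hs hs'
  simp only [hs]
  exact (constField_triCoord hs' (W s)).symm.trans (constField_sum_repr b hs' _)

/-- Near `r`, the components of `dγ` in the coordinate fields are the derivatives of the coordinates
of `γ`. -/
theorem exists_coordinates (hγ : ContMDiffAt 𝓘(ℝ, ℝ × ℝ) 𝓘(ℝ, E) ∞ γ r) :
    ∃ c : Fin (Module.finrank ℝ E) → ℝ × ℝ → ℝ, (∀ i, ContDiffAt ℝ ∞ (c i) r) ∧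
      ∀ᶠ s in 𝓝 r, ∀ ξ : ℝ × ℝ, mfderiv 𝓘(ℝ, ℝ × ℝ) 𝓘(ℝ, E) γ s ξ
        = ∑ i, fderiv ℝ (c i) s ξ • coordField (γ r) i (γ s) := by
  let b := Module.finBasis ℝ E
  let L : ∀ i, E →L[ℝ] ℝ := fun i ↦ LinearMap.toContinuousLinearMap (b.coord i)
  have hφ : ContDiffAt ℝ ∞ (fun s ↦ extChartAt 𝓘(ℝ, E) (γ r) (γ s)) r :=
    (contMDiffAt_extChartAt.comp r hγ).contDiffAt
  refine ⟨fun i s ↦ L i (extChartAt 𝓘(ℝ, E) (γ r) (γ s)),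
    fun i ↦ (ContinuousLinearMap.contDiff _).contDiffAt.comp r hφ, ?_⟩
  filter_upwards [hγ.continuousAt.eventually (coordField_eventuallyEq (E := E) (γ r)),
    hγ.continuousAt.eventually ((chartAt E (γ r)).open_source.mem_nhds (mem_chart_source E _)),
    contMDiffAt_iff_contMDiffAt_nhds (by simp) |>.1 (hγ.of_le (m := 1) (by simp))]
    with s hs hs' hγs ξ
  simp only [hs]
  have hγs' := hγs.mdifferentiableAt one_ne_zero
  have hφs : MDifferentiableAt 𝓘(ℝ, E) 𝓘(ℝ, E) (extChartAt 𝓘(ℝ, E) (γ r)) (γ s) :=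
    mdifferentiableAt_extChartAt hs'
  have h1 := hφs.hasMFDerivAt.comp s hγs'.hasMFDerivAt
  have h2 : HasFDerivAt (fun s ↦ extChartAt 𝓘(ℝ, E) (γ r) (γ s))
    ((mfderiv 𝓘(ℝ, E) 𝓘(ℝ, E) (extChartAt 𝓘(ℝ, E) (γ r)) (γ s)).comp
      (mfderiv 𝓘(ℝ, ℝ × ℝ) 𝓘(ℝ, E) γ s)) s := h1.hasFDerivAt
  -- the trivialization at `γ r` is the differential of the chart at `γ r`
  have h3 : ∀ i, fderiv ℝ (fun s ↦ L i (extChartAt 𝓘(ℝ, E) (γ r) (γ s))) s ξ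
      = b.repr (triCoord (γ r) (γ s) (mfderiv 𝓘(ℝ, ℝ × ℝ) 𝓘(ℝ, E) γ s ξ)) i := fun i ↦ by
    rw [triCoord_eq_continuousLinearMapAt hs',
      TangentBundle.continuousLinearMapAt_trivializationAt hs']
    have := ((L i).hasFDerivAt.comp s h2).fderiv
    exact congrArg (fun A ↦ A ξ) this
  simp only [h3]
  rw [← constField_sum_repr b hs', constField_triCoord hs']

end Frame

/-! ### Commutators of covariant derivatives along a map -/

section Along

variable {E : Type*} [NormedAddCommGroup E] [NormedSpace ℝ E] [FiniteDimensional ℝ E]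
  {M : Type*} [TopologicalSpace M] [T2Space M] [ChartedSpace E M] [IsManifold 𝓘(ℝ, E) ∞ M]
  {γ : ℝ × ℝ → M} {W : ∀ r : ℝ × ℝ, TangentSpace 𝓘(ℝ, E) (γ r)} {r : ℝ × ℝ}

theorem SmoothAlong.congr {W' : ∀ r : ℝ × ℝ, TangentSpace 𝓘(ℝ, E) (γ r)}
    (hW : SmoothAlong γ W r) (h : ∀ᶠ s in 𝓝 r, W' s = W s) : SmoothAlong γ W' r :=
  ContMDiffAt.congr_of_eventuallyEq hW (h.mono fun s hs ↦ by simp [hs])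

theorem smoothAlong_sum {ι : Type*} [Fintype ι] (hγ : ContMDiffAt 𝓘(ℝ, ℝ × ℝ) 𝓘(ℝ, E) ∞ γ r)
    {f : ι → ℝ × ℝ → ℝ} {Z : ι → ∀ x : M, TangentSpace 𝓘(ℝ, E) x}
    (hf : ∀ i, ContDiffAt ℝ ∞ (f i) r) (hZ : ∀ i, CMDiff ∞ (T% (Z i))) :
    SmoothAlong γ (fun s ↦ ∑ i, f i s • Z i (γ s)) r := by
  refine contMDiffAt_totalSpace.2 ⟨hγ, ?_⟩
  have hz : ∀ i, ContDiffAt ℝ ∞ (fun s ↦ triCoord (γ r) (γ s) (Z i (γ s))) r := fun i ↦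
    (contMDiffAt_totalSpace.1 ((hZ i (γ r)).comp r hγ)).2.contDiffAt
  refine ContDiffAt.contMDiffAt ((ContDiffAt.sum (s := Finset.univ) fun i _ ↦
    (hf i).smul (hz i)).congr_of_eventuallyEq ?_)
  filter_upwards [hγ.continuousAt.eventually
    ((chartAt E (γ r)).open_source.mem_nhds (mem_chart_source E _))] with s hs
  exact triCoord_sum_smul hs _ _

theorem ContDiffAt.eventually_differentiableAt {f : ℝ × ℝ → ℝ} {r : ℝ × ℝ}
    (hf : ContDiffAt ℝ ∞ f r) : ∀ᶠ s in 𝓝 r, DifferentiableAt ℝ f s := by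
  filter_upwards [(hf.of_le (m := 1) (by simp)).eventually (by simp)] with s hs
  exact hs.differentiableAt (by simp)

theorem ContDiffAt.fderiv_const_apply {f : ℝ × ℝ → ℝ} {r : ℝ × ℝ}
    (hf : ContDiffAt ℝ ∞ f r) (ξ : ℝ × ℝ) : ContDiffAt ℝ ∞ (fun s ↦ fderiv ℝ f s ξ) r :=
  (hf.fderiv_right (m := ∞) (by simp)).clm_apply contDiffAt_const

theorem ContDiffAt.fderiv_fderiv_comm {f : ℝ × ℝ → ℝ} {r : ℝ × ℝ}
    (hf : ContDiffAt ℝ ∞ f r) (ξ η : ℝ × ℝ) :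
    fderiv ℝ (fun s ↦ fderiv ℝ f s ξ) r η = fderiv ℝ (fun s ↦ fderiv ℝ f s η) r ξ := by
  have hd : DifferentiableAt ℝ (fderiv ℝ f) r :=
    (hf.fderiv_right (m := ∞) (by simp)).differentiableAt (by simp)
  have h : ∀ ξ η, fderiv ℝ (fun s ↦ fderiv ℝ f s ξ) r η = fderiv ℝ (fderiv ℝ f) r η ξ := by
    intro ξ η
    rw [fderiv_clm_apply hd (differentiableAt_const ξ)]
    simp
  rw [h, h]
  exact (hf.isSymmSndFDerivAt (by
    rw [minSmoothness_of_isRCLikeNormedField]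
    exact WithTop.coe_le_coe.2 (le_top (a := (2 : ℕ∞))))) η ξ

theorem eventually_mdifferentiableAt (hγ : ContMDiffAt 𝓘(ℝ, ℝ × ℝ) 𝓘(ℝ, E) ∞ γ r) :
    ∀ᶠ s in 𝓝 r, MDifferentiableAt 𝓘(ℝ, ℝ × ℝ) 𝓘(ℝ, E) γ s := by
  filter_upwards [contMDiffAt_iff_contMDiffAt_nhds (by simp) |>.1 (hγ.of_le (m := 1) (by simp))]
    with s hs
  exact hs.mdifferentiableAt one_ne_zero

variable {cov : CovariantDerivative 𝓘(ℝ, E) E (TangentSpace 𝓘(ℝ, E) : M → Type _)}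

theorem contMDiff_cov_apply (hcov : CovariantDerivative.ContMDiffCovariantDerivative cov ∞)
    {Z Y : ∀ x : M, TangentSpace 𝓘(ℝ, E) x} (hZ : CMDiff ∞ (T% Z)) (hY : CMDiff ∞ (T% Y)) :
    CMDiff ∞ (T% (fun x ↦ cov Z x (Y x))) := by
  have h := hcov.contMDiff.contMDiff (σ := Z) (hZ.contMDiffOn.of_le (by simp))
  exact ContMDiff.clm_bundle_apply (contMDiffOn_univ.1 h) hY

/-- If `W = ∑ f_i Z_i` along `γ`, then `D_ξ W` is a combination of the fields `Z_i` and of their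
derivatives along coordinate fields; `c` are the coordinates of `γ`. -/
theorem covAlong_expansion {ι : Type*} [Fintype ι] (hγ : ContMDiffAt 𝓘(ℝ, ℝ × ℝ) 𝓘(ℝ, E) ∞ γ r)
    {f : ι → ℝ × ℝ → ℝ} {Z : ι → ∀ x : M, TangentSpace 𝓘(ℝ, E) x}
    (hf : ∀ i, ContDiffAt ℝ ∞ (f i) r) (hZ : ∀ i, CMDiff ∞ (T% (Z i)))
    (hW : ∀ᶠ s in 𝓝 r, W s = ∑ i, f i s • Z i (γ s))
    {c : Fin (Module.finrank ℝ E) → ℝ × ℝ → ℝ}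
    (hc : ∀ᶠ s in 𝓝 r, ∀ ξ : ℝ × ℝ, mfderiv 𝓘(ℝ, ℝ × ℝ) 𝓘(ℝ, E) γ s ξ
        = ∑ i, fderiv ℝ (c i) s ξ • coordField (γ r) i (γ s)) (ξ : ℝ × ℝ) :
    ∀ᶠ s in 𝓝 r, covAlong cov γ W s ξ
      = ∑ k : ι ⊕ ι × Fin (Module.finrank ℝ E),
        Sum.elim (fun i s ↦ fderiv ℝ (f i) s ξ) (fun p s ↦ f p.1 s * fderiv ℝ (c p.2) s ξ) k s •
        Sum.elim Z (fun p x ↦ cov (Z p.1) x (coordField (γ r) p.2 x)) k (γ s) := by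
  filter_upwards [eventually_mdifferentiableAt hγ, hW.eventually_nhds, hc,
    Filter.eventually_all.2 fun i ↦ (hf i).eventually_differentiableAt] with s hγs hWs hcs hfs
  rw [covAlong_eq_sum cov hγs hfs
    (fun i ↦ (hZ i (γ s)).mdifferentiableAt (by simp)) hWs ξ, hcs ξ, Fintype.sum_sum_type,
    Fintype.sum_prod_type, Finset.sum_add_distrib]
  simp only [Sum.elim_inl, Sum.elim_inr, map_sum, map_smul, Finset.smul_sum, smul_smul]

theorem SmoothAlong.covAlong (hcov : CovariantDerivative.ContMDiffCovariantDerivative cov ∞)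
    (hW : SmoothAlong γ W r) (ξ : ℝ × ℝ) :
    SmoothAlong γ (fun s ↦ covAlong cov γ W s ξ) r := by
  have hγ := hW.contMDiffAt
  obtain ⟨f, hf, hWf⟩ := hW.exists_coeff
  obtain ⟨c, hc, hγc⟩ := exists_coordinates hγ
  have hZ := contMDiff_coordField (E := E) (γ r)
  refine (smoothAlong_sum hγ ?_ ?_).congr (covAlong_expansion (cov := cov) hγ hf hZ hWf hγc ξ)
  · rintro (i | p)
    · exact (hf i).fderiv_const_apply ξ
    · exact (hf p.1).mul ((hc p.2).fderiv_const_apply ξ)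
  · rintro (i | p)
    · exact hZ i
    · exact contMDiff_cov_apply hcov (hZ p.1) (hZ p.2)

/-- Second derivative of `W = ∑ f_i Z_i` along `γ`, sorted so that all terms but the last one are
symmetric under the exchange of `ξ` and `η`. -/
theorem covAlong_covAlong (hcov : CovariantDerivative.ContMDiffCovariantDerivative cov ∞)
    {ι : Type*} [Fintype ι] (hγ : ContMDiffAt 𝓘(ℝ, ℝ × ℝ) 𝓘(ℝ, E) ∞ γ r)
    {f : ι → ℝ × ℝ → ℝ} {Z : ι → ∀ x : M, TangentSpace 𝓘(ℝ, E) x}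
    (hf : ∀ i, ContDiffAt ℝ ∞ (f i) r) (hZ : ∀ i, CMDiff ∞ (T% (Z i)))
    (hW : ∀ᶠ s in 𝓝 r, W s = ∑ i, f i s • Z i (γ s))
    {c : Fin (Module.finrank ℝ E) → ℝ × ℝ → ℝ} (hcs : ∀ i, ContDiffAt ℝ ∞ (c i) r)
    (hc : ∀ᶠ s in 𝓝 r, ∀ ξ : ℝ × ℝ, mfderiv 𝓘(ℝ, ℝ × ℝ) 𝓘(ℝ, E) γ s ξ
        = ∑ i, fderiv ℝ (c i) s ξ • coordField (γ r) i (γ s)) (ξ η : ℝ × ℝ) :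
    covAlong cov γ (fun s ↦ covAlong cov γ W s η) r ξ
      = ∑ i, (fderiv ℝ (fun s ↦ fderiv ℝ (f i) s η) r ξ • Z i (γ r)
        + (fderiv ℝ (f i) r η • cov (Z i) (γ r) (mfderiv 𝓘(ℝ, ℝ × ℝ) 𝓘(ℝ, E) γ r ξ)
          + fderiv ℝ (f i) r ξ • cov (Z i) (γ r) (mfderiv 𝓘(ℝ, ℝ × ℝ) 𝓘(ℝ, E) γ r η))
        + f i r • ∑ j, fderiv ℝ (fun s ↦ fderiv ℝ (c j) s η) r ξ •
            cov (Z i) (γ r) (coordField (γ r) j (γ r))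
        + f i r • ∑ j, ∑ k, (fderiv ℝ (c j) r ξ * fderiv ℝ (c k) r η) •
            cov (fun x ↦ cov (Z i) x (coordField (γ r) k x)) (γ r)
              (coordField (γ r) j (γ r))) := by
  have hs := contMDiff_coordField (E := E) (γ r)
  have hF : ∀ k : ι ⊕ ι × Fin (Module.finrank ℝ E), ContDiffAt ℝ ∞
      (Sum.elim (fun i s ↦ fderiv ℝ (f i) s η) (fun p s ↦ f p.1 s * fderiv ℝ (c p.2) s η) k) r := by
    rintro (i | p)
    · exact (hf i).fderiv_const_apply η
    · exact (hf p.1).mul ((hcs p.2).fderiv_const_apply η)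
  rw [covAlong_eq_sum cov (hγ.mdifferentiableAt (by simp))
    (fun k ↦ (hF k).differentiableAt (by simp)) ?_
    (covAlong_expansion (cov := cov) hγ hf hZ hW hc η) ξ]
  · rw [Fintype.sum_sum_type, Fintype.sum_prod_type, ← Finset.sum_add_distrib]
    refine Finset.sum_congr rfl fun i _ ↦ ?_
    simp only [Sum.elim_inl, Sum.elim_inr]
    have hd : ∀ j, fderiv ℝ (fun s ↦ f i s * fderiv ℝ (c j) s η) r ξ
        = f i r * fderiv ℝ (fun s ↦ fderiv ℝ (c j) s η) r ξ
          + fderiv ℝ (c j) r η * fderiv ℝ (f i) r ξ := fun j ↦ by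
      rw [fderiv_fun_mul ((hf i).differentiableAt (by simp))
        (((hcs j).fderiv_const_apply η).differentiableAt (by simp))]
      rfl
    have h1 : ∀ ξ, cov (Z i) (γ r) (mfderiv 𝓘(ℝ, ℝ × ℝ) 𝓘(ℝ, E) γ r ξ)
        = ∑ j, fderiv ℝ (c j) r ξ • cov (Z i) (γ r) (coordField (γ r) j (γ r)) := fun ξ ↦ by
      rw [hc.self_of_nhds ξ]
      simp only [map_sum, map_smul]
    have h2 : ∀ k, cov (fun x ↦ cov (Z i) x (coordField (γ r) k x)) (γ r)
        (mfderiv 𝓘(ℝ, ℝ × ℝ) 𝓘(ℝ, E) γ r ξ)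
        = ∑ j, fderiv ℝ (c j) r ξ • cov (fun x ↦ cov (Z i) x (coordField (γ r) k x)) (γ r)
          (coordField (γ r) j (γ r)) := fun k ↦ by
      rw [hc.self_of_nhds ξ]
      simp only [map_sum, map_smul]
    simp only [hd, h2]
    rw [Finset.sum_comm (s := Finset.univ (α := Fin (Module.finrank ℝ E)))]
    rw [h1 η]
    simp only [Finset.sum_add_distrib, add_smul, Finset.smul_sum, smul_smul, mul_comm,
      mul_left_comm]
    abel
  · rintro (i | p)
    · exact (hZ i (γ r)).mdifferentiableAt (by simp)
    · exact ((contMDiff_cov_apply hcov (hZ p.1) (hs p.2)) (γ r)).mdifferentiableAt (by simp)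

/-- The commutator of second derivatives along `γ` is the curvature. The symmetric terms of
`covAlong_covAlong` cancel, and the coordinate fields have no bracket at `γ r`. -/
theorem covAlong_commutator (hcov : CovariantDerivative.ContMDiffCovariantDerivative cov ∞)
    {ι : Type*} [Fintype ι] (hγ : ContMDiffAt 𝓘(ℝ, ℝ × ℝ) 𝓘(ℝ, E) ∞ γ r)
    {f : ι → ℝ × ℝ → ℝ} {Z : ι → ∀ x : M, TangentSpace 𝓘(ℝ, E) x}
    (hf : ∀ i, ContDiffAt ℝ ∞ (f i) r) (hZ : ∀ i, CMDiff ∞ (T% (Z i)))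
    (hW : ∀ᶠ s in 𝓝 r, W s = ∑ i, f i s • Z i (γ s))
    {c : Fin (Module.finrank ℝ E) → ℝ × ℝ → ℝ} (hcs : ∀ i, ContDiffAt ℝ ∞ (c i) r)
    (hc : ∀ᶠ s in 𝓝 r, ∀ ξ : ℝ × ℝ, mfderiv 𝓘(ℝ, ℝ × ℝ) 𝓘(ℝ, E) γ s ξ
        = ∑ i, fderiv ℝ (c i) s ξ • coordField (γ r) i (γ s)) (ξ η : ℝ × ℝ) :
    covAlong cov γ (fun s ↦ covAlong cov γ W s η) r ξ
        - covAlong cov γ (fun s ↦ covAlong cov γ W s ξ) r η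
      = ∑ i, f i r • ∑ j, ∑ k, (fderiv ℝ (c j) r ξ * fderiv ℝ (c k) r η) •
          curvatureAt cov (coordField (γ r) j) (coordField (γ r) k) (Z i) (γ r) := by
  rw [covAlong_covAlong hcov hγ hf hZ hW hcs hc, covAlong_covAlong hcov hγ hf hZ hW hcs hc,
    ← Finset.sum_sub_distrib]
  refine Finset.sum_congr rfl fun i _ ↦ ?_
  simp only [curvatureAt, mlieBracket_coordField, map_zero, sub_zero, smul_sub,
    Finset.sum_sub_distrib]
  rw [(hf i).fderiv_fderiv_comm ξ η]
  simp only [(hcs _).fderiv_fderiv_comm ξ η]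
  rw [Finset.sum_comm (f := fun j k ↦ (fderiv ℝ (c j) r ξ * fderiv ℝ (c k) r η) •
    cov (fun x ↦ cov (Z i) x (coordField (γ r) j x)) (γ r) (coordField (γ r) k (γ r)))]
  simp only [mul_comm (fderiv ℝ (c _) r ξ)]
  abel

/-- The torsion of the connection is the defect of the symmetry of `D dγ`. -/
theorem covAlong_mfderiv_sub (hγ : ContMDiffAt 𝓘(ℝ, ℝ × ℝ) 𝓘(ℝ, E) ∞ γ r) (ξ η : ℝ × ℝ) :
    covAlong cov γ (fun s ↦ mfderiv 𝓘(ℝ, ℝ × ℝ) 𝓘(ℝ, E) γ s η) r ξ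
        - covAlong cov γ (fun s ↦ mfderiv 𝓘(ℝ, ℝ × ℝ) 𝓘(ℝ, E) γ s ξ) r η
      = cov.torsion (γ r) (mfderiv 𝓘(ℝ, ℝ × ℝ) 𝓘(ℝ, E) γ r ξ)
          (mfderiv 𝓘(ℝ, ℝ × ℝ) 𝓘(ℝ, E) γ r η) := by
  obtain ⟨c, hcs, hc⟩ := exists_coordinates hγ
  have hs := mdifferentiableAt_coordField (E := E) (γ r)
  have h : ∀ ξ η : ℝ × ℝ, covAlong cov γ (fun s ↦ mfderiv 𝓘(ℝ, ℝ × ℝ) 𝓘(ℝ, E) γ s η) r ξ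
      = ∑ i, fderiv ℝ (fun s ↦ fderiv ℝ (c i) s η) r ξ • coordField (γ r) i (γ r)
        + ∑ i, ∑ j, (fderiv ℝ (c i) r ξ * fderiv ℝ (c j) r η) •
          cov (coordField (γ r) j) (γ r) (coordField (γ r) i (γ r)) := by
    intro ξ η
    rw [covAlong_eq_sum cov (hγ.mdifferentiableAt (by simp))
      (fun k ↦ ((hcs k).fderiv_const_apply η).differentiableAt (by simp))
      (fun i ↦ hs i (γ r)) (hc.mono fun s hs ↦ hs η), hc.self_of_nhds ξ, Finset.sum_add_distrib]
    simp only [map_sum, map_smul, Finset.smul_sum, smul_smul]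
    rw [Finset.sum_comm]
    simp only [mul_comm]
  have ht : ∀ i j, cov.torsion (γ r) (coordField (γ r) i (γ r)) (coordField (γ r) j (γ r))
      = cov (coordField (γ r) j) (γ r) (coordField (γ r) i (γ r))
        - cov (coordField (γ r) i) (γ r) (coordField (γ r) j (γ r)) := fun i j ↦ by
    rw [cov.torsion_apply (hs i _) (hs j _), mlieBracket_coordField, sub_zero]
  rw [h ξ η, h η ξ, hc.self_of_nhds ξ, hc.self_of_nhds η]
  simp only [map_sum, map_smul, sum_apply, smul_apply, ht, (hcs _).fderiv_fderiv_comm ξ η]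
  simp only [Finset.smul_sum, smul_smul, smul_sub, Finset.sum_sub_distrib]
  rw [Finset.sum_comm (f := fun i j ↦ (fderiv ℝ (c i) r η * fderiv ℝ (c j) r ξ) •
    cov (coordField (γ r) j) (γ r) (coordField (γ r) i (γ r)))]
  rw [add_sub_add_left_eq_sub]
  congr 1
  rw [Finset.sum_comm]
  simp only [mul_comm]

end Along

/-! ### Parallelism of the metric and of the projections -/

section Projection

variable {E : Type*} [NormedAddCommGroup E] [NormedSpace ℝ E] [FiniteDimensional ℝ E]
  {M : Type*} [TopologicalSpace M] [T2Space M] [ChartedSpace E M] [IsManifold 𝓘(ℝ, E) ∞ M]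
  {m : ℕ} {N : NConnection E M m} {g : DMetric N} {D : DConnection g}
  {γ : ℝ × ℝ → M} {V W : ∀ r : ℝ × ℝ, TangentSpace 𝓘(ℝ, E) (γ r)} {r : ℝ × ℝ}

theorem SmoothAlong.contDiffAt_metric (g : DMetric N) (hV : SmoothAlong γ V r)
    (hW : SmoothAlong γ W r) : ContDiffAt ℝ ∞ (fun s ↦ g.val (γ s) (V s) (W s)) r := by
  have hγ := hV.contMDiffAt
  have : ContMDiffAt 𝓘(ℝ, ℝ × ℝ) (𝓘(ℝ, E).prod 𝓘(ℝ)) ∞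
      (fun s ↦ TotalSpace.mk' ℝ (E := Bundle.Trivial M ℝ) (γ s) (g.val (γ s) (V s) (W s))) r := by
    apply ContMDiffAt.clm_bundle_apply₂ (F₁ := E) (F₂ := E)
    · exact (g.contMDiff.contMDiffAt (x := γ r)).comp r hγ
    · exact hV
    · exact hW
  simp only [contMDiffAt_totalSpace] at this
  exact this.2.contDiffAt

theorem contMDiff_metric (g : DMetric N) {Y Z : ∀ x : M, TangentSpace 𝓘(ℝ, E) x}
    (hY : CMDiff ∞ (T% Y)) (hZ : CMDiff ∞ (T% Z)) :
    CMDiff ∞ (fun x ↦ g.val x (Y x) (Z x)) := by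
  intro x
  have : ContMDiffAt 𝓘(ℝ, E) (𝓘(ℝ, E).prod 𝓘(ℝ)) ∞
      (fun x ↦ TotalSpace.mk' ℝ (E := Bundle.Trivial M ℝ) x (g.val x (Y x) (Z x))) x := by
    apply ContMDiffAt.clm_bundle_apply₂ (F₁ := E) (F₂ := E)
    · exact g.contMDiff.contMDiffAt
    · exact hY x
    · exact hZ x
  simp only [contMDiffAt_totalSpace] at this
  exact this.2

/-- The metric is parallel along a map. -/
theorem fderiv_metric (D : DConnection g) (hV : SmoothAlong γ V r) (hW : SmoothAlong γ W r)
    (ξ : ℝ × ℝ) :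
    fderiv ℝ (fun s ↦ g.val (γ s) (V s) (W s)) r ξ
      = g.val (γ r) (covAlong D.cov γ V r ξ) (W r)
        + g.val (γ r) (V r) (covAlong D.cov γ W r ξ) := by
  have hγ := (hV.contMDiffAt).mdifferentiableAt (by simp)
  obtain ⟨f, hf, hVf⟩ := hV.exists_coeff
  obtain ⟨h, hh, hWh⟩ := hW.exists_coeff
  have hs := contMDiff_coordField (E := E) (γ r)
  have hsd := mdifferentiableAt_coordField (E := E) (γ r)
  let dγ : ℝ × ℝ →L[ℝ] E := mfderiv 𝓘(ℝ, ℝ × ℝ) 𝓘(ℝ, E) γ r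
  let dG : Fin (Module.finrank ℝ E) → Fin (Module.finrank ℝ E) → E →L[ℝ] ℝ := fun i j ↦
    mvfderiv 𝓘(ℝ, E) (fun x ↦ g.val x (coordField (γ r) i x) (coordField (γ r) j x)) (γ r)
  have hG : ∀ i j, HasFDerivAt
      (fun s ↦ g.val (γ s) (coordField (γ r) i (γ s)) (coordField (γ r) j (γ s)))
      ((dG i j).comp dγ) r := fun i j ↦ by
    have := ((contMDiff_metric g (hs i) (hs j) (γ r)).mdifferentiableAt
      (by simp)).hasMFDerivAt.comp r hγ.hasMFDerivAt
    exact this.hasFDerivAt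
  have hfd := fun i ↦ ((hf i).differentiableAt (by simp)).hasFDerivAt
  have hhd := fun i ↦ ((hh i).differentiableAt (by simp)).hasFDerivAt
  have hsum := HasFDerivAt.fun_sum (u := Finset.univ) fun i _ ↦
    HasFDerivAt.fun_sum (u := Finset.univ) fun j _ ↦ ((hfd i).mul (hhd j)).mul (hG i j)
  have heq : (fun s ↦ g.val (γ s) (V s) (W s)) =ᶠ[𝓝 r] fun s ↦ ∑ i, ∑ j, f i s * h j s *
      g.val (γ s) (coordField (γ r) i (γ s)) (coordField (γ r) j (γ s)) := by
    filter_upwards [hVf, hWh] with s h1 h2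
    rw [h1, h2]
    simp only [map_sum, map_smul, sum_apply, smul_apply, smul_eq_mul, Finset.mul_sum, mul_assoc]
    rw [Finset.sum_comm]
    refine Finset.sum_congr rfl fun i _ ↦ Finset.sum_congr rfl fun j _ ↦ ?_
    ring
  rw [(hsum.congr_of_eventuallyEq heq).fderiv,
    covAlong_eq_sum D.cov hγ (fun i ↦ (hfd i).differentiableAt) (fun i ↦ hsd i _) hVf,
    covAlong_eq_sum D.cov hγ (fun i ↦ (hhd i).differentiableAt) (fun i ↦ hsd i _) hWh,
    hVf.self_of_nhds, hWh.self_of_nhds]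
  simp only [map_sum, map_smul, map_add, sum_apply, smul_apply, add_apply, smul_eq_mul,
    Finset.mul_sum]
  simp only [← Finset.sum_add_distrib]
  rw [Finset.sum_comm]
  refine Finset.sum_congr rfl fun j _ ↦ Finset.sum_congr rfl fun i _ ↦ ?_
  have hm : dG i j (dγ ξ) = _ := D.metric (γ r) _ _ (hsd i (γ r)) (hsd j (γ r))
    (mfderiv 𝓘(ℝ, ℝ × ℝ) 𝓘(ℝ, E) γ r ξ)
  rw [ContinuousLinearMap.comp_apply, hm, Pi.mul_apply]
  ring

/-- A smooth field of projections of the tangent bundle which is parallel. Smoothness is stated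
through the action on smooth vector fields. -/
structure IsParallelProjection (D : DConnection g)
    (P : ∀ x : M, TangentSpace 𝓘(ℝ, E) x →L[ℝ] TangentSpace 𝓘(ℝ, E) x) : Prop where
  smooth : ∀ Z : ∀ x : M, TangentSpace 𝓘(ℝ, E) x, CMDiff ∞ (T% Z) →
    CMDiff ∞ (T% (fun x ↦ P x (Z x)))
  parallel : ∀ (x : M) (Z : ∀ y : M, TangentSpace 𝓘(ℝ, E) y), MDiffAt (T% Z) x →
    ∀ ξ : TangentSpace 𝓘(ℝ, E) x, D.cov (fun y ↦ P y (Z y)) x ξ = P x (D.cov Z x ξ)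
  idem : ∀ (x : M) (ξ : TangentSpace 𝓘(ℝ, E) x), P x (P x ξ) = P x ξ

theorem isParallelProjection_vproj (D : DConnection g) : IsParallelProjection D N.vproj where
  smooth _ hZ := ContMDiff.clm_bundle_apply N.contMDiff hZ
  parallel := D.preserves
  idem := N.idem

theorem isParallelProjection_hproj (D : DConnection g) : IsParallelProjection D N.hproj where
  smooth _ hZ := hZ.sub_section (ContMDiff.clm_bundle_apply N.contMDiff hZ)
  parallel x Z hZ ξ := by
    have hv : MDiffAt (T% (fun y ↦ N.vproj y (Z y))) x :=
      MDifferentiableAt.clm_bundle_apply (N.contMDiff.mdifferentiableAt (by simp)) hZ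
    have hh : MDiffAt (T% (fun y ↦ N.hproj y (Z y))) x := mdifferentiableAt_sub_section hZ hv
    have hadd := D.cov.isCovariantDerivativeOnUniv.add hh hv
    have hsum : ((fun y ↦ N.hproj y (Z y)) + fun y ↦ N.vproj y (Z y)) = Z := by
      funext y
      simp [NConnection.hproj]
    rw [hsum] at hadd
    have := congrArg (fun A ↦ A ξ) hadd
    simp only [add_apply] at this
    rw [D.preserves x Z hZ ξ] at this
    simp only [NConnection.hproj, sub_apply, ContinuousLinearMap.id_apply] at this ⊢
    exact eq_sub_of_add_eq this.symm
  idem x ξ := by simp [NConnection.hproj, N.idem]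

variable {P : ∀ x : M, TangentSpace 𝓘(ℝ, E) x →L[ℝ] TangentSpace 𝓘(ℝ, E) x}

theorem SmoothAlong.exists_coeff_apply (hW : SmoothAlong γ W r)
    (P : ∀ x : M, TangentSpace 𝓘(ℝ, E) x →L[ℝ] TangentSpace 𝓘(ℝ, E) x) :
    ∃ f : Fin (Module.finrank ℝ E) → ℝ × ℝ → ℝ, (∀ i, ContDiffAt ℝ ∞ (f i) r) ∧
      (∀ᶠ s in 𝓝 r, W s = ∑ i, f i s • coordField (γ r) i (γ s)) ∧
      ∀ᶠ s in 𝓝 r, P (γ s) (W s) = ∑ i, f i s • P (γ s) (coordField (γ r) i (γ s)) := by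
  obtain ⟨f, hf, hWf⟩ := hW.exists_coeff
  refine ⟨f, hf, hWf, hWf.mono fun s hs ↦ ?_⟩
  rw [hs]
  simp only [map_sum, map_smul]

theorem IsParallelProjection.smoothAlong (hP : IsParallelProjection D P)
    (hW : SmoothAlong γ W r) : SmoothAlong γ (fun s ↦ P (γ s) (W s)) r := by
  obtain ⟨f, hf, -, hPf⟩ := hW.exists_coeff_apply P
  exact (smoothAlong_sum hW.contMDiffAt hf
    fun i ↦ hP.smooth _ (contMDiff_coordField (γ r) i)).congr hPf

theorem IsParallelProjection.covAlong (hP : IsParallelProjection D P)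
    (hW : SmoothAlong γ W r) (ξ : ℝ × ℝ) :
    covAlong D.cov γ (fun s ↦ P (γ s) (W s)) r ξ = P (γ r) (covAlong D.cov γ W r ξ) := by
  obtain ⟨f, hf, hWf, hPf⟩ := hW.exists_coeff_apply P
  have hγ := (hW.contMDiffAt).mdifferentiableAt (by simp)
  have hsd := mdifferentiableAt_coordField (E := E) (γ r)
  have hPd := fun i ↦ (hP.smooth _ (contMDiff_coordField (γ r) i) (γ r)).mdifferentiableAt (by simp)
  have hfd := fun i ↦ (hf i).differentiableAt (by simp)
  rw [covAlong_eq_sum D.cov hγ hfd (fun i ↦ hsd i _) hWf,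
    covAlong_eq_sum D.cov hγ hfd hPd hPf]
  simp only [map_sum, map_add, map_smul, hP.parallel _ _ (hsd _ _)]

/-- The second covariant derivatives of a section of `P TM` along a map commute up to the constant
curvature of `P TM`. -/
theorem HasConstantCurvature.covAlong_commutator (hP : IsParallelProjection D P) {κ : ℝ}
    (hκ : HasConstantCurvature D P κ) (hW : SmoothAlong γ W r)
    (hPW : ∀ᶠ s in 𝓝 r, P (γ s) (W s) = W s) (ξ η : ℝ × ℝ) :
    _root_.covAlong D.cov γ (fun s ↦ _root_.covAlong D.cov γ W s η) r ξ
        - _root_.covAlong D.cov γ (fun s ↦ _root_.covAlong D.cov γ W s ξ) r η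
      = κ • (g.val (γ r) (P (γ r) (mfderiv 𝓘(ℝ, ℝ × ℝ) 𝓘(ℝ, E) γ r η)) (W r) •
            P (γ r) (mfderiv 𝓘(ℝ, ℝ × ℝ) 𝓘(ℝ, E) γ r ξ)
          - g.val (γ r) (P (γ r) (mfderiv 𝓘(ℝ, ℝ × ℝ) 𝓘(ℝ, E) γ r ξ)) (W r) •
            P (γ r) (mfderiv 𝓘(ℝ, ℝ × ℝ) 𝓘(ℝ, E) γ r η)) := by
  obtain ⟨f, hf, hWf, hPf⟩ := hW.exists_coeff_apply P
  obtain ⟨c, hcs, hc⟩ := exists_coordinates hW.contMDiffAt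
  have hs := contMDiff_coordField (E := E) (γ r)
  have hWP : ∀ᶠ s in 𝓝 r, W s = ∑ i, f i s • P (γ s) (coordField (γ r) i (γ s)) := by
    filter_upwards [hPW, hPf] with s h1 h2
    rw [← h1, h2]
  rw [_root_.covAlong_commutator D.smooth hW.contMDiffAt hf (fun i ↦ hP.smooth _ (hs i)) hWP hcs hc]
  have hR : ∀ i j k, curvatureAt D.cov (coordField (γ r) j) (coordField (γ r) k)
      (fun x ↦ P x (coordField (γ r) i x)) (γ r) = _ := fun i j k ↦
    hκ (γ r) _ _ _ (hs j (γ r)) (hs k (γ r)) (hP.smooth _ (hs i) (γ r)) fun y ↦ hP.idem y _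
  simp only [hR]
  rw [hc.self_of_nhds ξ, hc.self_of_nhds η, hWP.self_of_nhds]
  simp only [map_sum, map_smul, sum_apply, smul_apply, smul_eq_mul, Finset.sum_smul,
    Finset.smul_sum, smul_sub, smul_smul, Finset.sum_sub_distrib, Finset.mul_sum, Finset.sum_mul]
  congr 1
  · rw [Finset.sum_comm]
    refine Finset.sum_congr rfl fun j _ ↦ Finset.sum_congr rfl fun i _ ↦
      Finset.sum_congr rfl fun k _ ↦ ?_
    congr 1
    ring
  · refine (Finset.sum_congr rfl fun i _ ↦ Finset.sum_comm).trans ?_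
    rw [Finset.sum_comm]
    refine Finset.sum_congr rfl fun k _ ↦ Finset.sum_congr rfl fun i _ ↦
      Finset.sum_congr rfl fun j _ ↦ ?_
    congr 1
    ring

end Projection

/-! ### Parallel orthonormal frames along a flow -/

section StructureEquations

variable {E : Type*} [NormedAddCommGroup E] [NormedSpace ℝ E] [FiniteDimensional ℝ E]
  {M : Type*} [TopologicalSpace M] [T2Space M] [ChartedSpace E M] [IsManifold 𝓘(ℝ, E) ∞ M]
  {m : ℕ} {N : NConnection E M m} {g : DMetric N} {D : DConnection g}
  {γ : ℝ × ℝ → M} {V W : ∀ r : ℝ × ℝ, TangentSpace 𝓘(ℝ, E) (γ r)} {r : ℝ × ℝ}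
  {P : ∀ x : M, TangentSpace 𝓘(ℝ, E) x →L[ℝ] TangentSpace 𝓘(ℝ, E) x}

theorem covAlong_congr (cov : CovariantDerivative 𝓘(ℝ, E) E (TangentSpace 𝓘(ℝ, E) : M → Type _))
    (h : ∀ᶠ s in 𝓝 r, V s = W s) (ξ : ℝ × ℝ) : covAlong cov γ V r ξ = covAlong cov γ W r ξ := by
  have h1 : (fun s ↦ (tangentTriv E (γ r) (TotalSpace.mk' E (γ s) (V s))).2) =ᶠ[𝓝 r]
      fun s ↦ (tangentTriv E (γ r) (TotalSpace.mk' E (γ s) (W s))).2 :=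
    h.mono fun s hs ↦ by simp only [hs]
  unfold covAlong
  simp only [h1.fderiv_eq, h.self_of_nhds]

theorem smoothAlong_mfderiv (hγ : ContMDiffAt 𝓘(ℝ, ℝ × ℝ) 𝓘(ℝ, E) ∞ γ r) (ξ : ℝ × ℝ) :
    SmoothAlong γ (fun s ↦ mfderiv 𝓘(ℝ, ℝ × ℝ) 𝓘(ℝ, E) γ s ξ) r := by
  obtain ⟨c, hcs, hc⟩ := exists_coordinates hγ
  exact (smoothAlong_sum hγ (fun i ↦ (hcs i).fderiv_const_apply ξ)
    fun i ↦ contMDiff_coordField (γ r) i).congr (hc.mono fun s hs ↦ hs ξ)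

theorem hasDerivAt_metric_snd (D : DConnection g) {τ l : ℝ} (hV : SmoothAlong γ V (τ, l))
    (hW : SmoothAlong γ W (τ, l)) :
    HasDerivAt (fun s ↦ g.val (γ (τ, s)) (V (τ, s)) (W (τ, s)))
      (g.val (γ (τ, l)) (covAlong D.cov γ V (τ, l) (0, 1)) (W (τ, l))
        + g.val (γ (τ, l)) (V (τ, l)) (covAlong D.cov γ W (τ, l) (0, 1))) l := by
  have h := ((hV.contDiffAt_metric g hW).differentiableAt (by simp)).hasFDerivAt
  have h2 := h.comp_hasDerivAt (f := fun s : ℝ ↦ (τ, s)) l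
    ((hasDerivAt_const l τ).prodMk (hasDerivAt_id l))
  rw [fderiv_metric D hV hW] at h2
  exact h2

theorem hasDerivAt_metric_fst (D : DConnection g) {τ l : ℝ} (hV : SmoothAlong γ V (τ, l))
    (hW : SmoothAlong γ W (τ, l)) :
    HasDerivAt (fun t ↦ g.val (γ (t, l)) (V (t, l)) (W (t, l)))
      (g.val (γ (τ, l)) (covAlong D.cov γ V (τ, l) (1, 0)) (W (τ, l))
        + g.val (γ (τ, l)) (V (τ, l)) (covAlong D.cov γ W (τ, l) (1, 0))) τ := by
  have h := ((hV.contDiffAt_metric g hW).differentiableAt (by simp)).hasFDerivAt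
  have h2 := h.comp_hasDerivAt (f := fun t : ℝ ↦ (t, l)) τ
    ((hasDerivAt_id τ).prodMk (hasDerivAt_const τ l))
  rw [fderiv_metric D hV hW] at h2
  exact h2

/-- An orthonormal system of `k + 1` vectors in a space of dimension `k + 1` is a basis, in any
signature. -/
theorem eq_sum_of_orthonormal {F : Type*} [AddCommGroup F] [Module ℝ F] (B : F →ₗ[ℝ] F →ₗ[ℝ] ℝ)
    {ι : Type*} [Fintype ι] [DecidableEq ι] (S : Submodule ℝ F) [FiniteDimensional ℝ S]
    (hS : Module.finrank ℝ S = Fintype.card ι) (e : ι → F) (he : ∀ i, e i ∈ S) (η : ι → ℝ)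
    (hη : ∀ i, η i * η i = 1) (horth : ∀ i j, B (e i) (e j) = if i = j then η i else 0)
    {u : F} (hu : u ∈ S) : u = ∑ i, (η i * B u (e i)) • e i := by
  have hli : LinearIndependent ℝ e := by
    rw [Fintype.linearIndependent_iff]
    intro c hc i
    have h := congrArg (fun x ↦ B x (e i)) hc
    simp only [map_sum, map_smul, LinearMap.sum_apply, LinearMap.smul_apply, horth, smul_eq_mul,
      mul_ite, mul_zero, Finset.sum_ite_eq', Finset.mem_univ, if_true, map_zero,
      LinearMap.zero_apply] at h
    have : c i * (η i * η i) = 0 := by rw [← mul_assoc, h, zero_mul]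
    rwa [hη, mul_one] at this
  have hspan : Submodule.span ℝ (Set.range e) = S :=
    Submodule.eq_of_le_of_finrank_eq (Submodule.span_le.2 (by rintro _ ⟨i, rfl⟩; exact he i))
      (by rw [finrank_span_eq_card hli, hS])
  rw [← hspan] at hu
  obtain ⟨c, rfl⟩ := (Submodule.mem_span_range_iff_exists_fun ℝ).1 hu
  refine Finset.sum_congr rfl fun i _ ↦ ?_
  congr 1
  simp only [map_sum, map_smul, LinearMap.sum_apply, LinearMap.smul_apply, horth, smul_eq_mul,
      mul_ite, mul_zero, Finset.sum_ite_eq', Finset.mem_univ, if_true]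
  rw [mul_left_comm, hη, mul_one]

variable {T : Set ℝ} {k : ℕ} {ε : Fin k → ℝ}

namespace ParallelFrame

theorem sign_mul_self (F : ParallelFrame D P γ T ε) (i : Fin k) : ε i * ε i = 1 := by
  rcases F.sign i with h | h <;> simp [h]

theorem smoothAlong (F : ParallelFrame D P γ T ε) (hT : IsOpen T)
    (hr : r ∈ T ×ˢ (Set.univ : Set ℝ)) (i : Fin (k + 1)) : SmoothAlong γ (F.vec i) r :=
  (F.contMDiffOn i).contMDiffAt ((hT.prod isOpen_univ).mem_nhds hr)

theorem eventually_adapted (F : ParallelFrame D P γ T ε) (hT : IsOpen T)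
    (hr : r ∈ T ×ˢ (Set.univ : Set ℝ)) (i : Fin (k + 1)) :
    ∀ᶠ s in 𝓝 r, P (γ s) (F.vec i s) = F.vec i s := by
  filter_upwards [(hT.prod isOpen_univ).mem_nhds hr] with s hs
  exact F.adapted s hs i

theorem proj_covAlong (F : ParallelFrame D P γ T ε) (hP : IsParallelProjection D P) (hT : IsOpen T)
    (hr : r ∈ T ×ˢ (Set.univ : Set ℝ)) (i : Fin (k + 1)) (ξ : ℝ × ℝ) :
    P (γ r) (covAlong D.cov γ (F.vec i) r ξ) = covAlong D.cov γ (F.vec i) r ξ := by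
  rw [← hP.covAlong (F.smoothAlong hT hr i)]
  exact covAlong_congr D.cov (F.eventually_adapted hT hr i) ξ

/-- The connection matrix of an orthonormal frame is skew. -/
theorem metric_covAlong (F : ParallelFrame D P γ T ε) (hT : IsOpen T)
    (hr : r ∈ T ×ˢ (Set.univ : Set ℝ)) (i j : Fin (k + 1)) (ξ : ℝ × ℝ) :
    g.val (γ r) (covAlong D.cov γ (F.vec i) r ξ) (F.vec j r)
      = -g.val (γ r) (covAlong D.cov γ (F.vec j) r ξ) (F.vec i r) := by
  have h := fderiv_metric D (F.smoothAlong hT hr i) (F.smoothAlong hT hr j) ξ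
  have hconst : (fun s ↦ g.val (γ s) (F.vec i s) (F.vec j s)) =ᶠ[𝓝 r]
      fun _ ↦ if i = j then (Fin.cons 1 ε : Fin (k + 1) → ℝ) i else 0 := by
    filter_upwards [(hT.prod isOpen_univ).mem_nhds hr] with s hs
    exact F.orthonormal s hs i j
  rw [hconst.fderiv_eq, fderiv_const_apply, g.symm (γ r) (F.vec i r)] at h
  exact eq_neg_of_add_eq_zero_left h.symm

theorem metric_covAlong_self (F : ParallelFrame D P γ T ε) (hT : IsOpen T)
    (hr : r ∈ T ×ˢ (Set.univ : Set ℝ)) (i : Fin (k + 1)) (ξ : ℝ × ℝ) :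
    g.val (γ r) (covAlong D.cov γ (F.vec i) r ξ) (F.vec i r) = 0 := by
  have := F.metric_covAlong hT hr i i ξ
  linarith

theorem eq_sum (F : ParallelFrame D P γ T ε)
    (hrank : ∀ x, Module.finrank ℝ (LinearMap.range (P x).toLinearMap) = k + 1)
    (hr : r ∈ T ×ˢ (Set.univ : Set ℝ)) {u : TangentSpace 𝓘(ℝ, E) (γ r)} (hu : P (γ r) u = u) :
    u = g.val (γ r) u (F.vec 0 r) • F.vec 0 r
      + ∑ i : Fin k, (ε i * g.val (γ r) u (F.vec i.succ r)) • F.vec i.succ r := by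
  have : FiniteDimensional ℝ (TangentSpace 𝓘(ℝ, E) (γ r)) := inferInstanceAs (FiniteDimensional ℝ E)
  have h := eq_sum_of_orthonormal (F := TangentSpace 𝓘(ℝ, E) (γ r))
    ((ContinuousLinearMap.coeLM ℝ).comp (g.val (γ r)).toLinearMap)
    (LinearMap.range (P (γ r)).toLinearMap) ((hrank _).trans (Fintype.card_fin _).symm)
    (fun i ↦ F.vec i r) (fun i ↦ ⟨F.vec i r, F.adapted r hr i⟩) (Fin.cons 1 ε)
    (by
      intro i
      refine Fin.cases ?_ (fun i ↦ ?_) i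
      · simp
      · simpa using F.sign_mul_self i)
    (fun i j ↦ F.orthonormal r hr i j) (u := u) ⟨u, hu⟩
  rw [Fin.sum_univ_succ] at h
  simpa using h

end ParallelFrame
end StructureEquations

/-! ### The structure equations -/

section StructureEquations

variable {E : Type*} [NormedAddCommGroup E] [NormedSpace ℝ E] [FiniteDimensional ℝ E]
  {M : Type*} [TopologicalSpace M] [T2Space M] [ChartedSpace E M] [IsManifold 𝓘(ℝ, E) ∞ M]
  {m : ℕ} {N : NConnection E M m} {g : DMetric N} {D : DConnection g}
  {γ : ℝ × ℝ → M} {P : ∀ x : M, TangentSpace 𝓘(ℝ, E) x →L[ℝ] TangentSpace 𝓘(ℝ, E) x}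
  {T : Set ℝ} {k : ℕ} {ε : Fin k → ℝ}

namespace ParallelFrame

/-- `D_l E_0 = - ∑ v_i E_i`. -/
theorem covAlong_vec_zero (F : ParallelFrame D P γ T ε) (hP : IsParallelProjection D P)
    (hrank : ∀ x, Module.finrank ℝ (LinearMap.range (P x).toLinearMap) = k + 1)
    (hT : IsOpen T) {τ l : ℝ} (hr : (τ, l) ∈ T ×ˢ (Set.univ : Set ℝ)) :
    covAlong D.cov γ (F.vec 0) (τ, l) (0, 1)
      = -∑ i : Fin k, F.data.v τ l i • F.vec i.succ (τ, l) := by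
  have h := F.eq_sum hrank hr (F.proj_covAlong hP hT hr 0 (0, 1))
  rw [F.metric_covAlong_self hT hr, zero_smul, zero_add] at h
  rw [h, ← Finset.sum_neg_distrib]
  refine Finset.sum_congr rfl fun i _ ↦ ?_
  simp only [data, neg_smul, neg_neg]

/-- `D_l E_i = ε_i v_i E_0`: the frame is parallel. -/
theorem covAlong_vec_succ (F : ParallelFrame D P γ T ε) (hT : IsOpen T) {τ l : ℝ}
    (hr : (τ, l) ∈ T ×ˢ (Set.univ : Set ℝ)) (i : Fin k) :
    covAlong D.cov γ (F.vec i.succ) (τ, l) (0, 1) = (ε i * F.data.v τ l i) • F.vec 0 (τ, l) := by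
  obtain ⟨a, ha⟩ := F.parallel _ hr i
  have h := F.metric_covAlong hT hr i.succ 0 (0, 1)
  rw [ha, map_smul, smul_apply, F.orthonormal _ hr] at h
  simp only [if_true, Fin.cons_zero, smul_eq_mul, mul_one] at h
  rw [ha, h]
  congr 1
  simp only [data]
  linear_combination (-(g.val (γ (τ, l)) (covAlong D.cov γ (F.vec 0) (τ, l) (0, 1)))
    (F.vec i.succ (τ, l))) * (-1) * F.sign_mul_self i

/-- The matrix of `D_τ` on the normal vectors of the frame is skew with respect to `diag ε`. -/
theorem theta_skew (F : ParallelFrame D P γ T ε) (hT : IsOpen T) {τ l : ℝ}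
    (hr : (τ, l) ∈ T ×ˢ (Set.univ : Set ℝ)) (i j : Fin k) :
    ε j * F.data.Θ τ l i j = -(ε i * F.data.Θ τ l j i) := by
  have h := F.metric_covAlong hT hr i.succ j.succ (1, 0)
  have hi := F.sign_mul_self i
  have hj := F.sign_mul_self j
  simp only [data]
  rw [h]
  linear_combination (g.val (γ (τ, l)) (covAlong D.cov γ (F.vec j.succ) (τ, l) (1, 0)))
    (F.vec i.succ (τ, l)) * (hj - hi)

/-- Vanishing torsion along the flow: `D_l (P γ_τ) = D_τ E_0`. -/
theorem covAlong_proj_flowVec (F : ParallelFrame D P γ T ε) (hP : IsParallelProjection D P)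
    (hT : IsOpen T) (hγ : ContMDiffOn 𝓘(ℝ, ℝ × ℝ) 𝓘(ℝ, E) ∞ γ (T ×ˢ Set.univ))
    (htors : ∀ r ∈ T ×ˢ (Set.univ : Set ℝ),
      D.cov.torsion (γ r) (tangentVec γ r) (flowVec γ r) = 0)
    {r : ℝ × ℝ} (hr : r ∈ T ×ˢ (Set.univ : Set ℝ)) :
    covAlong D.cov γ (fun s ↦ P (γ s) (flowVec γ s)) r (0, 1)
      = covAlong D.cov γ (F.vec 0) r (1, 0) := by
  have hnhds := (hT.prod isOpen_univ).mem_nhds hr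
  have hγr := hγ.contMDiffAt hnhds
  have h1 := covAlong_mfderiv_sub (cov := D.cov) hγr (0, 1) (1, 0)
  have h2 : covAlong D.cov γ (flowVec γ) r (0, 1) = covAlong D.cov γ (tangentVec γ) r (1, 0) :=
    sub_eq_zero.1 (h1.trans (htors r hr))
  rw [hP.covAlong (W := flowVec γ) (smoothAlong_mfderiv hγr (1, 0)), h2,
    ← hP.covAlong (W := tangentVec γ) (smoothAlong_mfderiv hγr (0, 1))]
  refine covAlong_congr D.cov ?_ _
  filter_upwards [hnhds] with s hs
  exact (F.tangent s hs).symm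

/-- The curvature hypothesis at `(γ_l, γ_τ)`, on a vector of the frame. -/
theorem covAlong_commutator (F : ParallelFrame D P γ T ε) (hP : IsParallelProjection D P)
    {κ : ℝ} (hκ : HasConstantCurvature D P κ) (hT : IsOpen T)
    {r : ℝ × ℝ} (hr : r ∈ T ×ˢ (Set.univ : Set ℝ)) (i : Fin (k + 1)) :
    covAlong D.cov γ (fun s ↦ covAlong D.cov γ (F.vec i) s (1, 0)) r (0, 1)
        - covAlong D.cov γ (fun s ↦ covAlong D.cov γ (F.vec i) s (0, 1)) r (1, 0)
      = κ • (g.val (γ r) (P (γ r) (flowVec γ r)) (F.vec i r) • F.vec 0 r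
          - g.val (γ r) (F.vec 0 r) (F.vec i r) • P (γ r) (flowVec γ r)) := by
  rw [hκ.covAlong_commutator hP (F.smoothAlong hT hr i) (F.eventually_adapted hT hr i),
    F.tangent r hr]
  rfl

/-- The torsion and curvature structure equations, in components. -/
theorem satisfiesStructureEqs (F : ParallelFrame D P γ T ε) (hP : IsParallelProjection D P)
    (hrank : ∀ x, Module.finrank ℝ (LinearMap.range (P x).toLinearMap) = k + 1)
    {κ : ℝ} (hκ : HasConstantCurvature D P κ) (hT : IsOpen T)
    (hγ : ContMDiffOn 𝓘(ℝ, ℝ × ℝ) 𝓘(ℝ, E) ∞ γ (T ×ˢ Set.univ))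
    (htors : ∀ r ∈ T ×ˢ (Set.univ : Set ℝ),
      D.cov.torsion (γ r) (tangentVec γ r) (flowVec γ r) = 0) :
    SatisfiesStructureEqs T ε κ F.data := by
  intro τ hτ l
  have hr : (τ, l) ∈ T ×ˢ (Set.univ : Set ℝ) := ⟨hτ, trivial⟩
  have hγr := hγ.contMDiffAt ((hT.prod isOpen_univ).mem_nhds hr)
  have hs := F.smoothAlong hT hr
  have hY : SmoothAlong γ (fun s ↦ P (γ s) (flowVec γ s)) (τ, l) :=
    hP.smoothAlong (smoothAlong_mfderiv hγr (1, 0))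
  have hDY := F.covAlong_proj_flowVec hP hT hγ htors hr
  have hD0 := F.covAlong_vec_zero hP hrank hT hr
  have hDi := F.covAlong_vec_succ hT hr
  have hε := F.sign_mul_self
  have h0 : ∀ i : Fin k, g.val (γ (τ, l)) (F.vec 0 (τ, l)) (F.vec i.succ (τ, l)) = 0 := fun i ↦ by
    rw [F.orthonormal _ hr, if_neg (Fin.succ_ne_zero i).symm]
  have h00 : g.val (γ (τ, l)) (F.vec 0 (τ, l)) (F.vec 0 (τ, l)) = 1 := by
    rw [F.orthonormal _ hr]
    simp
  have hcomm := F.covAlong_commutator hP hκ hT hr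
  have hsτ := fun i ↦ (hs i).covAlong D.smooth (1, 0)
  have hsl := fun i ↦ (hs i).covAlong D.smooth (0, 1)
  refine ⟨?_, ?_, ?_, fun i j ↦ ?_, F.theta_skew hT hr⟩
  · refine (hasDerivAt_metric_snd D hY (hs 0)).congr_deriv ?_
    rw [hDY, F.metric_covAlong_self hT hr, zero_add, hD0]
    simp only [map_neg, map_sum, map_smul, smul_eq_mul, dotp]
    congr 1
    refine Finset.sum_congr rfl fun i _ ↦ ?_
    change F.data.v τ l i * _ = ε i * F.data.v τ l i * (ε i * _)
    linear_combination (-(F.data.v τ l i *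
      g.val (γ (τ, l)) (P (γ (τ, l)) (flowVec γ (τ, l))) (F.vec i.succ (τ, l)))) * hε i
  · rw [hasDerivAt_pi]
    intro i
    refine ((hasDerivAt_metric_snd D hY (hs i.succ)).const_mul (ε i)).congr_deriv ?_
    rw [hDY, hDi, map_smul, smul_eq_mul]
    have hϖ : F.data.ϖ τ l i = -(ε i * g.val (γ (τ, l))
      (covAlong D.cov γ (F.vec 0) (τ, l) (1, 0)) (F.vec i.succ (τ, l))) := rfl
    have he : F.data.ePar τ l = g.val (γ (τ, l)) (P (γ (τ, l)) (flowVec γ (τ, l)))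
      (F.vec 0 (τ, l)) := rfl
    rw [Pi.sub_apply, Pi.smul_apply, smul_eq_mul, hϖ, he]
    linear_combination F.data.v τ l i * g.val (γ (τ, l)) (P (γ (τ, l)) (flowVec γ (τ, l)))
      (F.vec 0 (τ, l)) * hε i
  · refine ⟨fun i ↦ _, hasDerivAt_pi.2 fun i ↦
      ((hasDerivAt_metric_snd D (hsτ 0) (hs i.succ)).const_mul (ε i)).neg, hasDerivAt_pi.2 fun i ↦
      ((hasDerivAt_metric_fst D (hsl 0) (hs i.succ)).const_mul (ε i)).neg.congr_deriv ?_⟩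
    have hc := congrArg (fun u ↦ g.val (γ (τ, l)) u (F.vec i.succ (τ, l))) (hcomm 0)
    simp only [map_sub, sub_apply, map_smul, smul_apply, smul_eq_mul, h0, h00] at hc
    -- `D_l E_i` is a multiple of `E_0`, to which `D_τ E_0` is normal
    have h1 : g.val (γ (τ, l)) (covAlong D.cov γ (F.vec 0) (τ, l) (1, 0))
        (covAlong D.cov γ (F.vec i.succ) (τ, l) (0, 1)) = 0 := by
      rw [hDi, map_smul, F.metric_covAlong_self hT hr, smul_zero]
    have h2 : Matrix.vecMul (F.data.v τ l) (F.data.Θ τ l) i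
        = -(ε i * g.val (γ (τ, l)) (covAlong D.cov γ (F.vec 0) (τ, l) (0, 1))
            (covAlong D.cov γ (F.vec i.succ) (τ, l) (1, 0))) := by
      rw [hD0]
      simp only [map_neg, neg_apply, map_sum, sum_apply, map_smul, smul_apply, smul_eq_mul,
        mul_neg, neg_neg, Finset.mul_sum, Matrix.vecMul, dotProduct]
      refine Finset.sum_congr rfl fun j _ ↦ ?_
      have h3 := F.metric_covAlong hT hr i.succ j.succ (1, 0)
      rw [g.symm (γ (τ, l)) (F.vec j.succ (τ, l)), h3]
      simp only [data]
      ring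
    have he : F.data.ePerp τ l i = ε i * g.val (γ (τ, l)) (P (γ (τ, l)) (flowVec γ (τ, l)))
      (F.vec i.succ (τ, l)) := rfl
    simp only [Pi.sub_apply, Pi.add_apply, Pi.smul_apply, smul_eq_mul]
    rw [h1, h2, he]
    linear_combination ε i * hc
  · refine ((hasDerivAt_metric_snd D (hsτ i.succ) (hs j.succ)).const_mul (ε j)).neg.congr_deriv ?_
    have hc := congrArg (fun u ↦ g.val (γ (τ, l)) u (F.vec j.succ (τ, l))) (hcomm i.succ)
    simp only [map_sub, sub_apply, map_smul, smul_apply, smul_eq_mul, h0] at hc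
    -- `D_τ D_l E_i` is paired with `E_j` by differentiating `g (D_l E_i) E_j = 0`
    have h1 : g.val (γ (τ, l))
          (covAlong D.cov γ (fun s ↦ covAlong D.cov γ (F.vec i.succ) s (0, 1)) (τ, l) (1, 0))
          (F.vec j.succ (τ, l))
        + g.val (γ (τ, l)) (covAlong D.cov γ (F.vec i.succ) (τ, l) (0, 1))
          (covAlong D.cov γ (F.vec j.succ) (τ, l) (1, 0)) = 0 := by
      refine (hasDerivAt_metric_fst D (hsl i.succ) (hs j.succ)).unique
        ((hasDerivAt_const τ (0 : ℝ)).congr_of_eventuallyEq ?_)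
      filter_upwards [hT.mem_nhds hτ] with t ht
      have hr' : (t, l) ∈ T ×ˢ (Set.univ : Set ℝ) := ⟨ht, trivial⟩
      rw [F.covAlong_vec_succ hT hr' i, map_smul, smul_apply, F.orthonormal _ hr',
        if_neg (Fin.succ_ne_zero j).symm, smul_zero]
    have hd : ∀ i : Fin k, g.val (γ (τ, l)) (covAlong D.cov γ (F.vec i.succ) (τ, l) (1, 0))
        (F.vec 0 (τ, l)) = ε i * F.data.ϖ τ l i := fun i ↦ by
      rw [F.metric_covAlong hT hr i.succ 0]
      simp only [data]
      linear_combination g.val (γ (τ, l)) (covAlong D.cov γ (F.vec 0) (τ, l) (1, 0))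
        (F.vec i.succ (τ, l)) * hε i
    rw [hDi, map_smul, smul_apply, g.symm (γ (τ, l)) (F.vec 0 (τ, l)), hd] at h1
    rw [hDi, map_smul, hd]
    simp only [smul_eq_mul, wedge, outer, Matrix.sub_apply, Matrix.of_apply] at h1 ⊢
    linear_combination -ε j * hc - ε j * h1 + (ε i * F.data.v τ l i * F.data.ϖ τ l j
      - F.data.v τ l j * ε i * F.data.ϖ τ l i) * hε j

end ParallelFrame
end StructureEquations

/-! ### The flow equations -/

section FlowEquations

variable {k : ℕ}

theorem exists_add_const_of_hasDerivAt_eq {f h f' : ℝ → ℝ} (hf : ∀ l, HasDerivAt f (f' l) l)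
    (hh : ∀ l, HasDerivAt h (f' l) l) : ∃ a, ∀ l, f l = h l + a := by
  refine ⟨f 0 - h 0, fun l ↦ ?_⟩
  have hd : ∀ l, HasDerivAt (f - h) 0 l := fun l ↦ by simpa using (hf l).sub (hh l)
  have := is_const_of_deriv_eq_zero (fun l ↦ (hd l).differentiableAt) (fun l ↦ (hd l).deriv) l 0
  simp only [Pi.sub_apply] at this
  linarith

/-- The second structure equation gives `ϖ` from `e_⊥`, the third one `v_τ` from `ϖ`; `e_∥` and `Θ`
are eliminated by integration of the other two. -/
theorem SatisfiesStructureEqs.satisfiesFlowEqs {T : Set ℝ} {ε : Fin k → ℝ} {κ : ℝ} {f : FlowData k}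
    (hf : SatisfiesStructureEqs T ε κ f) : SatisfiesFlowEqs T ε κ f := by
  intro τ hτ Dinv hD1 hD2
  have hϖ : ∀ l, f.ϖ τ l = f.ePar τ l • f.v τ l - deriv (f.ePerp τ) l := fun l ↦ by
    rw [(hf τ hτ l).2.1.deriv]
    simp
  have hv : ∀ l, HasDerivAt (fun t ↦ f.v t l)
      (deriv (f.ϖ τ) l + Matrix.vecMul (f.v τ l) (f.Θ τ l) - κ • f.ePerp τ l) τ := fun l ↦ by
    obtain ⟨ϖ', h1, h2⟩ := (hf τ hτ l).2.2.1
    rwa [h1.deriv]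
  obtain ⟨a, ha⟩ := exists_add_const_of_hasDerivAt_eq (fun l ↦ (hf τ hτ l).1)
    (fun l ↦ (hD1 l).neg)
  choose A hA using fun i j ↦ exists_add_const_of_hasDerivAt_eq
    (fun l ↦ (hf τ hτ l).2.2.2.1 i j) (fun l ↦ hD2 i j l)
  refine ⟨⟨a, Matrix.of A, fun l ↦ ?_⟩, fun h1 h2 l ↦ ⟨?_, ?_⟩⟩
  · have hΘ : f.Θ τ l = wedgeInv Dinv ε (f.v τ) (f.ϖ τ) l + Matrix.of A := by
      ext i j
      exact hA i j l
    refine ⟨ha l, hΘ, ?_, ?_⟩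
    · rw [hϖ l, ha l]
      simp only [Pi.neg_apply, opJ]
      module
    · convert! hv l using 1
      rw [hΘ, Matrix.vecMul_add]
      simp only [opH]
      module
  · rw [hϖ l, h1 l]
    simp only [opJ]
    module
  · convert! hv l using 1
    rw [h2 l]
    rfl

end FlowEquations

/-! ### The skew-adjoint antiderivative -/

section SkewInverse

open Filter

/-- Continuous functions of compact support on the line. -/
def IsCc (f : ℝ → ℝ) : Prop := Continuous f ∧ HasCompactSupport f

namespace IsCc

variable {f g : ℝ → ℝ}

theorem integrable (hf : IsCc f) : Integrable f := hf.1.integrable_of_hasCompactSupport hf.2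

theorem add (hf : IsCc f) (hg : IsCc g) : IsCc (fun l ↦ f l + g l) :=
  ⟨hf.1.add hg.1, hf.2.add hg.2⟩

theorem neg (hf : IsCc f) : IsCc (fun l ↦ -f l) := ⟨hf.1.neg, hf.2.neg⟩

theorem sub (hf : IsCc f) (hg : IsCc g) : IsCc (fun l ↦ f l - g l) := by
  simpa only [sub_eq_add_neg] using hf.add hg.neg

theorem mul_left (hf : IsCc f) (hg : Continuous g) : IsCc (fun l ↦ g l * f l) :=
  ⟨hg.mul hf.1, hf.2.mul_left⟩

theorem mul_right (hf : IsCc f) (hg : Continuous g) : IsCc (fun l ↦ f l * g l) :=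
  ⟨hf.1.mul hg, hf.2.mul_right⟩

theorem const_mul (hf : IsCc f) (c : ℝ) : IsCc (fun l ↦ c * f l) := hf.mul_left continuous_const

theorem sum {ι : Type*} (s : Finset ι) {f : ι → ℝ → ℝ} (hf : ∀ i ∈ s, IsCc (f i)) :
    IsCc (fun l ↦ ∑ i ∈ s, f i l) := by
  classical
  induction s using Finset.induction_on with
  | empty =>
    simp only [Finset.sum_empty]
    exact ⟨continuous_const, HasCompactSupport.zero⟩
  | insert a s ha ih =>
    simp only [Finset.sum_insert ha]
    exact (hf a (Finset.mem_insert_self a s)).add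
      (ih fun i hi ↦ hf i (Finset.mem_insert_of_mem hi))

theorem exists_bound (hf : IsCc f) : ∃ r : ℝ, ∀ l, r ≤ |l| → f l = 0 := by
  obtain ⟨r, hr⟩ := hf.2.isCompact.isBounded.subset_ball 0
  refine ⟨r, fun l hl ↦ ?_⟩
  by_contra h
  have := hr (subset_tsupport f h)
  rw [mem_ball_zero_iff, Real.norm_eq_abs] at this
  linarith

theorem skewInv_eq (hf : IsCc f) (l : ℝ) :
    skewInv f l = (∫ s in Set.Iic l, f s) - (∫ s, f s) / 2 := by
  have := intervalIntegral.integral_Iic_add_Ioi (b := l) hf.integrable.integrableOn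
    hf.integrable.integrableOn
  rw [skewInv, ← this]
  ring

theorem eventually_skewInv_atTop (hf : IsCc f) :
    ∀ᶠ l in atTop, skewInv f l = (∫ s, f s) / 2 := by
  obtain ⟨r, hr⟩ := hf.exists_bound
  filter_upwards [eventually_ge_atTop (max r 0)] with l hl
  rw [hf.skewInv_eq, setIntegral_eq_integral_of_forall_compl_eq_zero]
  · ring
  · intro s hs
    rw [Set.mem_Iic, not_le] at hs
    have := le_max_left r 0
    exact hr s (by linarith [le_abs_self s])

theorem eventually_skewInv_atBot (hf : IsCc f) :
    ∀ᶠ l in atBot, skewInv f l = -((∫ s, f s) / 2) := by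
  obtain ⟨r, hr⟩ := hf.exists_bound
  filter_upwards [eventually_le_atBot (-r)] with l hl
  rw [hf.skewInv_eq, setIntegral_eq_zero_of_forall_eq_zero]
  · ring
  · intro s hs
    rw [Set.mem_Iic] at hs
    exact hr s (by linarith [neg_abs_le s])

theorem hasDerivAt_skewInv (hf : IsCc f) (l : ℝ) : HasDerivAt (skewInv f) (f l) l := by
  have h : skewInv f = fun l ↦ (∫ s in (0 : ℝ)..l, f s)
      + ((∫ s in Set.Iic (0 : ℝ), f s) - (∫ s, f s) / 2) := by
    ext l
    rw [hf.skewInv_eq, ← intervalIntegral.integral_Iic_sub_Iic hf.integrable.integrableOn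
      hf.integrable.integrableOn]
    ring
  rw [h]
  exact (intervalIntegral.integral_hasDerivAt_right (hf.1.intervalIntegrable _ _)
    (hf.1.stronglyMeasurableAtFilter _ _) hf.1.continuousAt).add_const _

theorem continuous_skewInv (hf : IsCc f) : Continuous (skewInv f) :=
  continuous_iff_continuousAt.2 fun l ↦ (hf.hasDerivAt_skewInv l).continuousAt

theorem contDiff_skewInv (hf : IsCc f) (h : ContDiff ℝ ∞ f) : ContDiff ℝ ∞ (skewInv f) := by
  rw [contDiff_infty_iff_deriv]
  refine ⟨fun l ↦ (hf.hasDerivAt_skewInv l).differentiableAt, ?_⟩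
  rwa [show deriv (skewInv f) = f from funext fun l ↦ (hf.hasDerivAt_skewInv l).deriv]

/-- The antiderivative of a function with vanishing integral again has compact support. -/
theorem skewInv_of_integral_eq_zero (hf : IsCc f) (h : ∫ s, f s = 0) : IsCc (skewInv f) := by
  refine ⟨hf.continuous_skewInv, ?_⟩
  rw [hasCompactSupport_iff_eventuallyEq, coclosedCompact_eq_cocompact,
    cocompact_eq_atBot_atTop]
  have h1 := hf.eventually_skewInv_atBot
  have h2 := hf.eventually_skewInv_atTop
  rw [h] at h1 h2
  simp only [zero_div, neg_zero] at h1 h2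
  exact eventually_sup.2 ⟨h1, h2⟩

end IsCc

theorem skewInv_const_mul (c : ℝ) (f : ℝ → ℝ) (l : ℝ) :
    skewInv (fun s ↦ c * f s) l = c * skewInv f l := by
  simp only [skewInv, integral_const_mul]
  ring

/-- The integral of the derivative of a compactly supported function vanishes. -/
theorem integral_eq_zero_of_hasDerivAt_of_isCc {G G' : ℝ → ℝ} (hG : ∀ l, HasDerivAt G (G' l) l)
    (h : HasCompactSupport G) (h' : Continuous G') : ∫ l, G' l = 0 := by
  have hc : Continuous G := continuous_iff_continuousAt.2 fun l ↦ (hG l).continuousAt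
  have hd : G' = deriv G := funext fun l ↦ (hG l).deriv.symm
  exact integral_eq_zero_of_hasDerivAt_of_integrable hG
    (h'.integrable_of_hasCompactSupport (hd ▸ h.deriv)) (hc.integrable_of_hasCompactSupport h)

/-- The bilinear form `(f, g) ↦ ∫ f D⁻¹ g`. -/
def skewForm (f g : ℝ → ℝ) : ℝ := ∫ l, f l * skewInv g l

namespace IsCc

variable {f f' g g' : ℝ → ℝ}

/-- `∫ f D⁻¹ g + g D⁻¹ f` is the integral of the derivative of `D⁻¹ f D⁻¹ g`, whose limits at
`± ∞` are both `¼ ∫ f ∫ g`. -/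
theorem skewForm_swap (hf : IsCc f) (hg : IsCc g) : skewForm f g = -skewForm g f := by
  have hi1 : Integrable (fun l ↦ f l * skewInv g l) :=
    (hf.mul_right hg.continuous_skewInv).integrable
  have hi2 : Integrable (fun l ↦ skewInv f l * g l) :=
    (hg.mul_left hf.continuous_skewInv).integrable
  have key := integral_of_hasDerivAt_of_tendsto (f := fun l ↦ skewInv f l * skewInv g l)
    (f' := fun l ↦ f l * skewInv g l + skewInv f l * g l)
    (m := -((∫ s, f s) / 2) * -((∫ s, g s) / 2)) (n := (∫ s, f s) / 2 * ((∫ s, g s) / 2))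
    (fun l ↦ (hf.hasDerivAt_skewInv l).mul (hg.hasDerivAt_skewInv l)) (hi1.add hi2)
    (tendsto_const_nhds.congr' <| by
      filter_upwards [hf.eventually_skewInv_atBot, hg.eventually_skewInv_atBot] with l h1 h2
      rw [h1, h2])
    (tendsto_const_nhds.congr' <| by
      filter_upwards [hf.eventually_skewInv_atTop, hg.eventually_skewInv_atTop] with l h1 h2
      rw [h1, h2])
  rw [integral_add hi1 hi2] at key
  simp only [skewForm, mul_comm (g _)]
  linarith

theorem skewForm_add_left (hf : IsCc f) (hf' : IsCc f') (hg : IsCc g) :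
    skewForm (fun l ↦ f l + f' l) g = skewForm f g + skewForm f' g := by
  simp only [skewForm, add_mul]
  exact integral_add (hf.mul_right hg.continuous_skewInv).integrable
    (hf'.mul_right hg.continuous_skewInv).integrable

theorem skewForm_add_right (hf : IsCc f) (hg : IsCc g) (hg' : IsCc g') :
    skewForm f (fun l ↦ g l + g' l) = skewForm f g + skewForm f g' := by
  rw [hf.skewForm_swap (hg.add hg'), hg.skewForm_add_left hg' hf, hf.skewForm_swap hg,
    hf.skewForm_swap hg']
  ring

end IsCc

theorem skewForm_const_mul_left (c : ℝ) (f g : ℝ → ℝ) :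
    skewForm (fun l ↦ c * f l) g = c * skewForm f g := by
  simp only [skewForm, mul_assoc, integral_const_mul]

theorem skewForm_const_mul_right (c : ℝ) (f g : ℝ → ℝ) :
    skewForm f (fun l ↦ c * g l) = c * skewForm f g := by
  simp only [skewForm, skewInv_const_mul, mul_left_comm _ c, integral_const_mul]

/-- Along affine families of functions the form is a quadratic polynomial in the parameter. -/
theorem IsCc.skewForm_add_smul {f f' g g' : ℝ → ℝ} (hf : IsCc f) (hf' : IsCc f') (hg : IsCc g)
    (hg' : IsCc g') (s : ℝ) :
    skewForm (fun l ↦ f l + s * f' l) (fun l ↦ g l + s * g' l)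
      = skewForm f g + s * (skewForm f' g + skewForm f g') + s ^ 2 * skewForm f' g' := by
  rw [hf.skewForm_add_left (hf'.const_mul s) (hg.add (hg'.const_mul s)),
    hf.skewForm_add_right hg (hg'.const_mul s),
    (hf'.const_mul s).skewForm_add_right hg (hg'.const_mul s)]
  simp only [skewForm_const_mul_left, skewForm_const_mul_right]
  ring

theorem hasDerivAt_quadratic (a b c : ℝ) :
    HasDerivAt (fun s : ℝ ↦ a + s * b + s ^ 2 * c) b 0 := by
  refine ((((hasDerivAt_id (0 : ℝ)).mul_const b).const_add a).add
    (((hasDerivAt_id (0 : ℝ)).pow 2).mul_const c)).congr_deriv ?_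
  simp

end SkewInverse

/-! ### The symplectic operators -/

section Symplectic

variable {k : ℕ} {ε : Fin k → ℝ}

namespace IsTestField

variable {v w a b : ℝ → Fin k → ℝ}

theorem isCc_apply (hw : IsTestField w) (i : Fin k) : IsCc (fun l ↦ w l i) :=
  ⟨(continuous_apply i).comp hw.1.continuous, hw.2.comp_left (g := fun x : Fin k → ℝ ↦ x i) rfl⟩

theorem contDiff_apply (hw : IsTestField w) (i : Fin k) : ContDiff ℝ ∞ (fun l ↦ w l i) :=
  contDiff_pi.1 hw.1 i

theorem hasDerivAt_apply (hw : IsTestField w) (i : Fin k) (l : ℝ) :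
    HasDerivAt (fun l ↦ w l i) (deriv w l i) l :=
  hasDerivAt_pi.1 (hw.1.differentiable (by simp) l).hasDerivAt i

protected theorem deriv (hw : IsTestField w) : IsTestField (deriv w) :=
  ⟨(contDiff_infty_iff_deriv.1 hw.1).2, hw.2.deriv⟩

theorem isCc_dotp (hw : IsTestField w) (hv : Continuous v) : IsCc (fun l ↦ dotp ε (v l) (w l)) :=
  IsCc.sum _ fun i _ ↦ (hw.isCc_apply i).mul_left
    (continuous_const.mul ((continuous_apply i).comp hv))

theorem contDiff_dotp (hw : IsTestField w) (hv : ContDiff ℝ ∞ v) :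
    ContDiff ℝ ∞ (fun l ↦ dotp ε (v l) (w l)) :=
  ContDiff.sum fun i _ ↦ (contDiff_const.mul (contDiff_pi.1 hv i)).mul (hw.contDiff_apply i)

end IsTestField

theorem dotp_comm (A B : Fin k → ℝ) : dotp ε A B = dotp ε B A :=
  Finset.sum_congr rfl fun i _ ↦ by ring

theorem dotp_add_smul_left (A B C : Fin k → ℝ) (s : ℝ) :
    dotp ε (A + s • B) C = dotp ε A C + s * dotp ε B C := by
  simp only [dotp, Finset.mul_sum, ← Finset.sum_add_distrib]
  exact Finset.sum_congr rfl fun i _ ↦ by simp only [Pi.add_apply, Pi.smul_apply, smul_eq_mul]; ring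

theorem dotp_add_right (A B C : Fin k → ℝ) : dotp ε A (B + C) = dotp ε A B + dotp ε A C := by
  simp only [dotp, ← Finset.sum_add_distrib]
  exact Finset.sum_congr rfl fun i _ ↦ by simp only [Pi.add_apply]; ring

theorem dotp_smul_right (A B : Fin k → ℝ) (s : ℝ) : dotp ε A (s • B) = s * dotp ε A B := by
  simp only [dotp, Finset.mul_sum]
  exact Finset.sum_congr rfl fun i _ ↦ by simp only [Pi.smul_apply, smul_eq_mul]; ring

/-- `D` is skew-adjoint. -/
theorem IsTestField.pairing_deriv {a b : ℝ → Fin k → ℝ} (ha : IsTestField a) (hb : IsTestField b) :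
    pairing ε a (deriv b) = -pairing ε b (deriv a) := by
  have h : ∀ l, HasDerivAt (fun l ↦ dotp ε (a l) (b l))
      (dotp ε (a l) (deriv b l) + dotp ε (b l) (deriv a l)) l := fun l ↦ by
    refine (HasDerivAt.fun_sum fun i _ ↦ ((ha.hasDerivAt_apply i l).const_mul (ε i)).mul
      (hb.hasDerivAt_apply i l)).congr_deriv ?_
    simp only [dotp, ← Finset.sum_add_distrib]
    exact Finset.sum_congr rfl fun i _ ↦ by ring
  have h1 := hb.deriv.isCc_dotp (ε := ε) ha.1.continuous
  have h2 := ha.deriv.isCc_dotp (ε := ε) hb.1.continuous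
  have := integral_eq_zero_of_hasDerivAt_of_isCc h (hb.isCc_dotp ha.1.continuous).2
    (h1.add h2).1
  rw [integral_add h1.integrable h2.integrable] at this
  simp only [pairing]
  linarith

/-- The two-form of `𝓙` is `∫ a · b' + ∫ (v · a) D⁻¹ (v · b)`. -/
theorem pairing_opJ {v a b : ℝ → Fin k → ℝ} (hv : Continuous v) (ha : IsTestField a)
    (hb : IsTestField b) : pairing ε a (opJ skewInv ε v b) = pairing ε a (deriv b)
      + skewForm (fun l ↦ dotp ε (v l) (a l)) (fun l ↦ dotp ε (v l) (b l)) := by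
  have h1 := hb.deriv.isCc_dotp (ε := ε) ha.1.continuous
  have h2 := (ha.isCc_dotp (ε := ε) hv).mul_right
    (hb.isCc_dotp (ε := ε) hv).continuous_skewInv
  simp only [pairing, skewForm]
  rw [← integral_add h1.integrable h2.integrable]
  congr 1 with l
  rw [opJ, dotp_add_right, dotp_smul_right, dotp_comm (a l) (v l)]
  ring

theorem hasDerivAt_pairing_opJ {v u a b : ℝ → Fin k → ℝ} (hv : Continuous v) (hu : Continuous u)
    (ha : IsTestField a) (hb : IsTestField b) :
    HasDerivAt (fun s : ℝ ↦ pairing ε a (opJ skewInv ε (v + s • u) b))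
      (skewForm (fun l ↦ dotp ε (u l) (a l)) (fun l ↦ dotp ε (v l) (b l))
        + skewForm (fun l ↦ dotp ε (v l) (a l)) (fun l ↦ dotp ε (u l) (b l))) 0 := by
  convert! (hasDerivAt_quadratic _ _ _).const_add (pairing ε a (deriv b)) using 1
  ext s
  rw [pairing_opJ (hv.add (hu.const_smul s)) ha hb]
  simp only [Pi.add_apply, Pi.smul_apply, dotp_add_smul_left]
  rw [(ha.isCc_dotp hv).skewForm_add_smul (ha.isCc_dotp hu) (hb.isCc_dotp hv) (hb.isCc_dotp hu)]

/-- The three derivatives are sums of the values of the skew form on the pairs formed of one of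
`v · a`, `v · b`, `v · c` and one of `a · b`, `b · c`, `c · a`; these cancel in the cyclic sum. -/
theorem isSymplecticOperator_opJ (ε : Fin k → ℝ) : IsSymplecticOperator ε (opJ skewInv ε) := by
  intro v hv
  refine ⟨fun a ha ↦ ?_, fun a b ha hb ↦ ?_, fun a b c ha hb hc ↦ ?_⟩
  · exact ha.deriv.1.add
      (((ha.isCc_dotp hv.continuous).contDiff_skewInv (ha.contDiff_dotp hv)).smul hv)
  · rw [pairing_opJ hv.continuous ha hb, pairing_opJ hv.continuous hb ha, ha.pairing_deriv hb,
      (ha.isCc_dotp hv.continuous).skewForm_swap (hb.isCc_dotp hv.continuous)]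
    ring
  · refine ⟨_, _, _, hasDerivAt_pairing_opJ hv.continuous ha.1.continuous hb hc,
      hasDerivAt_pairing_opJ hv.continuous hb.1.continuous hc ha,
      hasDerivAt_pairing_opJ hv.continuous hc.1.continuous ha hb, ?_⟩
    simp only [dotp_comm (c _) (a _), dotp_comm (b _) (a _), dotp_comm (c _) (b _)]
    rw [(hb.isCc_dotp hv.continuous).skewForm_swap (hc.isCc_dotp ha.1.continuous),
      (hc.isCc_dotp hv.continuous).skewForm_swap (hb.isCc_dotp ha.1.continuous),
      (ha.isCc_dotp hv.continuous).skewForm_swap (hc.isCc_dotp hb.1.continuous)]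
    ring

end Symplectic

/-! ### The algebraic part of the Jacobi identity -/

section JacobiAlgebra

variable {k : ℕ} {ε : Fin k → ℝ}

theorem sum_sum_sum_rotate (f : Fin k → Fin k → Fin k → ℝ) :
    ∑ i, ∑ j, ∑ m, f i j m = ∑ i, ∑ j, ∑ m, f m i j := by
  rw [Finset.sum_comm]
  have : ∀ j, ∑ i, ∑ m, f i j m = ∑ m, ∑ i, f i j m := fun j ↦ Finset.sum_comm
  simp only [this]

/-- The contraction `V · B C a` of two vectors with two matrices, all indices being contracted with
`diag ε`. -/
def chain (ε V : Fin k → ℝ) (B C : Fin k → Fin k → ℝ) (a : Fin k → ℝ) : ℝ :=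
  ∑ m, ∑ i, ∑ j, ε m * ε i * ε j * (V m * B m i * C i j * a j)

/-- Against a skew matrix both terms of `x yᵀ - y xᵀ` contribute equally. -/
theorem sum_wedge_mul_skew (x y : Fin k → ℝ) {Q : Fin k → Fin k → ℝ}
    (hQ : ∀ i j, Q j i = -Q i j) :
    ∑ i, ∑ j, ε i * ε j * ((x i * y j - x j * y i) * Q i j)
      = 2 * ∑ i, ∑ j, ε i * ε j * (x i * y j * Q i j) := by
  have h : ∑ i, ∑ j, ε i * ε j * (x j * y i * Q i j)
      = -∑ i, ∑ j, ε i * ε j * (x i * y j * Q i j) := by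
    rw [Finset.sum_comm]
    simp only [← Finset.sum_neg_distrib]
    refine Finset.sum_congr rfl fun i _ ↦ Finset.sum_congr rfl fun j _ ↦ ?_
    rw [hQ i j]
    ring
  rw [two_mul]
  nth_rewrite 2 [← neg_neg (∑ i, ∑ j, ε i * ε j * (x i * y j * Q i j))]
  rw [← h, ← sub_eq_add_neg]
  simp only [← Finset.sum_sub_distrib]
  exact Finset.sum_congr rfl fun i _ ↦ Finset.sum_congr rfl fun j _ ↦ by ring

/-- The contraction of `V aᵀ - a Vᵀ` with `B C`, for skew `B` and `C`. -/
theorem sum_wedge_mul_mul (V a : Fin k → ℝ) {B C : Fin k → Fin k → ℝ}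
    (hB : ∀ i j, B j i = -B i j) (hC : ∀ i j, C j i = -C i j) :
    ∑ i, ∑ j, ∑ m, ε i * ε j * ε m * ((V i * a j - V j * a i) * B j m * C m i)
      = chain ε V C B a - chain ε V B C a := by
  have h1 : ∑ i, ∑ j, ∑ m, ε i * ε j * ε m * (V i * a j * B j m * C m i) = chain ε V C B a := by
    refine Finset.sum_congr rfl fun i _ ↦ ?_
    rw [Finset.sum_comm]
    refine Finset.sum_congr rfl fun m _ ↦ Finset.sum_congr rfl fun j _ ↦ ?_
    rw [hB m j, hC i m]
    ring
  have h2 : ∑ i, ∑ j, ∑ m, ε i * ε j * ε m * (V j * a i * B j m * C m i) = chain ε V B C a := by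
    rw [sum_sum_sum_rotate]
    exact Finset.sum_congr rfl fun i _ ↦ Finset.sum_congr rfl fun j _ ↦
      Finset.sum_congr rfl fun m _ ↦ by ring
  rw [← h1, ← h2]
  simp only [← Finset.sum_sub_distrib]
  exact Finset.sum_congr rfl fun i _ ↦ Finset.sum_congr rfl fun j _ ↦
    Finset.sum_congr rfl fun m _ ↦ by ring

/-- The value of `∑ u_i (a_j C_ij - c_j A_ij)` at `u = x + V ⌟ B`. -/
theorem sum_flow_mul (V a c x : Fin k → ℝ) (A B C : Fin k → Fin k → ℝ) :
    ∑ i, ∑ j, ε i * ε j * ((x i + ∑ m, V m * (ε m * B m i)) * (a j * C i j - c j * A i j))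
      = ∑ i, ∑ j, ε i * ε j * (x i * (a j * C i j - c j * A i j))
        + (chain ε V B C a - chain ε V B A c) := by
  have h : ∀ (C : Fin k → Fin k → ℝ) (a : Fin k → ℝ),
      chain ε V B C a = ∑ i, ∑ j, ε i * ε j * ((∑ m, V m * (ε m * B m i)) * (a j * C i j)) := by
    intro C a
    rw [chain, Finset.sum_comm]
    refine Finset.sum_congr rfl fun i _ ↦ ?_
    rw [Finset.sum_comm]
    refine Finset.sum_congr rfl fun j _ ↦ ?_
    rw [Finset.sum_mul, Finset.mul_sum]
    exact Finset.sum_congr rfl fun m _ ↦ by ring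
  rw [h, h]
  simp only [← Finset.sum_sub_distrib, ← Finset.sum_add_distrib]
  exact Finset.sum_congr rfl fun i _ ↦ Finset.sum_congr rfl fun j _ ↦ by ring

/-- The terms `(b·V)(a·c) - (a·V)(b·c)` cancel in the cyclic sum: the summand is skew under the
exchange of the indices. -/
theorem sum_wedge_cyclic (V a b c : Fin k → ℝ) :
    ∑ i, ∑ j, ε i * ε j * (b i * a j * (V i * c j - V j * c i)
      + c i * b j * (V i * a j - V j * a i) + a i * c j * (V i * b j - V j * b i)) = 0 := by
  set S := ∑ i, ∑ j, ε i * ε j * (b i * a j * (V i * c j - V j * c i)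
      + c i * b j * (V i * a j - V j * a i) + a i * c j * (V i * b j - V j * b i)) with hS
  have h : S = -S := by
    nth_rewrite 1 [hS]
    rw [Finset.sum_comm, hS]
    simp only [← Finset.sum_neg_distrib]
    refine Finset.sum_congr rfl fun i _ ↦ Finset.sum_congr rfl fun j _ ↦ ?_
    ring
  linarith

/-- The integrand of the Jacobi identity, as the derivative of
`∑ (b_i a_j C_ij + c_i b_j A_ij + a_i c_j B_ij) - ∑ A_ij B_jm C_mi`
when `A' = V ∧ a`, `B' = V ∧ b`, `C' = V ∧ c`. -/
theorem jacobi_integrand (V a b c a' b' c' : Fin k → ℝ) {A B C : Fin k → Fin k → ℝ}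
    (hA : ∀ i j, A j i = -A i j) (hB : ∀ i j, B j i = -B i j) (hC : ∀ i j, C j i = -C i j) :
    ∑ i, ∑ j, ε i * ε j * ((b' i + ∑ m, V m * (ε m * B m i)) * (a j * C i j - c j * A i j))
      + ∑ i, ∑ j, ε i * ε j * ((c' i + ∑ m, V m * (ε m * C m i)) * (b j * A i j - a j * B i j))
      + ∑ i, ∑ j, ε i * ε j * ((a' i + ∑ m, V m * (ε m * A m i)) * (c j * B i j - b j * C i j))
    = ∑ i, ∑ j, ε i * ε j *
        (((b' i * a j + b i * a' j) * C i j + b i * a j * (V i * c j - V j * c i))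
        + ((c' i * b j + c i * b' j) * A i j + c i * b j * (V i * a j - V j * a i))
        + ((a' i * c j + a i * c' j) * B i j + a i * c j * (V i * b j - V j * b i)))
      - ∑ i, ∑ j, ∑ m, ε i * ε j * ε m *
        (((V i * a j - V j * a i) * B j m + A i j * (V j * b m - V m * b j)) * C m i
        + A i j * B j m * (V m * c i - V i * c m)) := by
  have h1 := sum_wedge_mul_mul (ε := ε) V a hB hC
  have h2 : ∑ i, ∑ j, ∑ m, ε i * ε j * ε m * (A i j * (V j * b m - V m * b j) * C m i)
      = chain ε V A C b - chain ε V C A b := by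
    rw [← sum_wedge_mul_mul V b hC hA, sum_sum_sum_rotate]
    exact Finset.sum_congr rfl fun i _ ↦ Finset.sum_congr rfl fun j _ ↦
      Finset.sum_congr rfl fun m _ ↦ by ring
  have h3 : ∑ i, ∑ j, ∑ m, ε i * ε j * ε m * (A i j * B j m * (V m * c i - V i * c m))
      = chain ε V B A c - chain ε V A B c := by
    rw [← sum_wedge_mul_mul V c hA hB,
      sum_sum_sum_rotate fun i j m ↦ ε i * ε j * ε m * ((V i * c j - V j * c i) * A j m * B m i)]
    exact Finset.sum_congr rfl fun i _ ↦ Finset.sum_congr rfl fun j _ ↦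
      Finset.sum_congr rfl fun m _ ↦ by ring
  -- the cubic terms, which cancel against the contributions of `V ⌟ A`, `V ⌟ B`, `V ⌟ C`
  have h4 : ∑ i, ∑ j, ∑ m, ε i * ε j * ε m *
        (((V i * a j - V j * a i) * B j m + A i j * (V j * b m - V m * b j)) * C m i
        + A i j * B j m * (V m * c i - V i * c m))
      = (chain ε V C B a - chain ε V B C a) + (chain ε V A C b - chain ε V C A b)
        + (chain ε V B A c - chain ε V A B c) := by
    rw [← h1, ← h2, ← h3]
    simp only [← Finset.sum_add_distrib]
    exact Finset.sum_congr rfl fun i _ ↦ Finset.sum_congr rfl fun j _ ↦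
      Finset.sum_congr rfl fun m _ ↦ by ring
  have h5 : ∀ (x y : Fin k → ℝ) {Q : Fin k → Fin k → ℝ}, (∀ i j, Q j i = -Q i j) →
      ∑ i, ∑ j, ε i * ε j * (x i * y j * Q i j)
        = -∑ i, ∑ j, ε i * ε j * (y i * x j * Q i j) := by
    intro x y Q hQ
    rw [Finset.sum_comm]
    simp only [← Finset.sum_neg_distrib]
    refine Finset.sum_congr rfl fun i _ ↦ Finset.sum_congr rfl fun j _ ↦ ?_
    rw [hQ i j]
    ring
  have h6 : ∑ i, ∑ j, ε i * ε j *
        (((b' i * a j + b i * a' j) * C i j + b i * a j * (V i * c j - V j * c i))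
        + ((c' i * b j + c i * b' j) * A i j + c i * b j * (V i * a j - V j * a i))
        + ((a' i * c j + a i * c' j) * B i j + a i * c j * (V i * b j - V j * b i)))
      = ∑ i, ∑ j, ε i * ε j * (b' i * a j * C i j) + ∑ i, ∑ j, ε i * ε j * (b i * a' j * C i j)
        + ∑ i, ∑ j, ε i * ε j * (c' i * b j * A i j) + ∑ i, ∑ j, ε i * ε j * (c i * b' j * A i j)
        + ∑ i, ∑ j, ε i * ε j * (a' i * c j * B i j)
        + ∑ i, ∑ j, ε i * ε j * (a i * c' j * B i j) + 0 := by
    rw [← sum_wedge_cyclic (ε := ε) V a b c]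
    simp only [← Finset.sum_add_distrib]
    exact Finset.sum_congr rfl fun i _ ↦ Finset.sum_congr rfl fun j _ ↦ by ring
  have h7 : ∀ (x a c : Fin k → ℝ) (A C : Fin k → Fin k → ℝ),
      ∑ i, ∑ j, ε i * ε j * (x i * (a j * C i j - c j * A i j))
        = ∑ i, ∑ j, ε i * ε j * (x i * a j * C i j)
          - ∑ i, ∑ j, ε i * ε j * (x i * c j * A i j) := by
    intro x a c A C
    simp only [← Finset.sum_sub_distrib]
    exact Finset.sum_congr rfl fun i _ ↦ Finset.sum_congr rfl fun j _ ↦ by ring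
  rw [sum_flow_mul, sum_flow_mul, sum_flow_mul, h4, h6, h7, h7, h7, h5 b a' hC, h5 c b' hA,
    h5 a c' hB]
  ring

end JacobiAlgebra

/-! ### The bivector of the cosymplectic operators and its derivative -/

section Cosymplectic

variable {k : ℕ} {ε : Fin k → ℝ} {u v α β χ : ℝ → Fin k → ℝ}

/-- The entries of `v αᵀ - α vᵀ`; the entries of `v ∧ α` are their multiples by `ε i`. -/
def cross (v α : ℝ → Fin k → ℝ) (i j : Fin k) (l : ℝ) : ℝ := v l i * α l j - v l j * α l i

/-- The skew-symmetric matrix `D⁻¹ (v αᵀ - α vᵀ)`. -/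
def crossInv (v α : ℝ → Fin k → ℝ) (i j : Fin k) : ℝ → ℝ := skewInv (cross v α i j)

theorem IsTestField.isCc_cross (hα : IsTestField α) (hv : Continuous v) (i j : Fin k) :
    IsCc (cross v α i j) :=
  ((hα.isCc_apply j).mul_left ((continuous_apply i).comp hv)).sub
    ((hα.isCc_apply i).mul_left ((continuous_apply j).comp hv))

theorem cross_add_smul_left (v u α : ℝ → Fin k → ℝ) (s : ℝ) (i j : Fin k) :
    cross (v + s • u) α i j = fun l ↦ cross v α i j l + s * cross u α i j l := by
  ext l
  simp only [cross, Pi.add_apply, Pi.smul_apply, smul_eq_mul]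
  ring

theorem crossInv_skew (v α : ℝ → Fin k → ℝ) (i j : Fin k) (l : ℝ) :
    crossInv v α j i l = -crossInv v α i j l := by
  rw [crossInv, crossInv, ← neg_one_mul, ← skewInv_const_mul]
  congr 1 with s
  simp only [cross]
  ring

theorem wedgeInv_apply (v α : ℝ → Fin k → ℝ) (i j : Fin k) (l : ℝ) :
    wedgeInv skewInv ε v α l i j = ε i * crossInv v α i j l := by
  rw [crossInv, ← skewInv_const_mul, wedgeInv, Matrix.of_apply]
  congr 1 with s
  simp only [wedge, outer, Matrix.sub_apply, Matrix.of_apply, cross]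
  ring

theorem opH_apply (v α : ℝ → Fin k → ℝ) (l : ℝ) (i : Fin k) :
    opH skewInv ε v α l i = deriv α l i + ∑ m, v l m * (ε m * crossInv v α m i l) := by
  simp only [opH, Pi.add_apply, Matrix.vecMul, dotProduct, wedgeInv_apply]

theorem IsTestField.contDiff_opH (hα : IsTestField α) (hv : ContDiff ℝ ∞ v) :
    ContDiff ℝ ∞ (opH skewInv ε v α) := by
  rw [contDiff_pi]
  intro i
  simp only [opH_apply]
  refine (hα.deriv.contDiff_apply i).add (ContDiff.sum fun m _ ↦ (contDiff_pi.1 hv m).mul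
    (contDiff_const.mul ?_))
  exact (hα.isCc_cross hv.continuous m i).contDiff_skewInv
    (((contDiff_pi.1 hv m).mul (hα.contDiff_apply i)).sub
      ((contDiff_pi.1 hv i).mul (hα.contDiff_apply m)))

/-- The bivector of `𝓗` is `∫ α · β' + ½ ∑ ε_i ε_j ∫ (v αᵀ - α vᵀ)_ij D⁻¹ (v βᵀ - β vᵀ)_ij`. -/
theorem pairing_opH (hv : Continuous v) (hα : IsTestField α) (hβ : IsTestField β) :
    pairing ε α (opH skewInv ε v β) = pairing ε α (deriv β)
      + ∑ i, ∑ j, ε i * ε j / 2 * skewForm (cross v α i j) (cross v β i j) := by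
  have h1 := hβ.deriv.isCc_dotp (ε := ε) hα.1.continuous
  have h2 : ∀ i j, IsCc fun l ↦ ε i * ε j / 2 * (cross v α i j l * crossInv v β i j l) := fun i j ↦
    ((hα.isCc_cross hv i j).mul_right (hβ.isCc_cross hv i j).continuous_skewInv).const_mul _
  have h3 : ∑ i, ∑ j, ε i * ε j / 2 * skewForm (cross v α i j) (cross v β i j)
      = ∫ l, ∑ i, ∑ j, ε i * ε j / 2 * (cross v α i j l * crossInv v β i j l) := by
    rw [integral_finsetSum _ fun i _ ↦ (IsCc.sum _ fun j _ ↦ h2 i j).integrable]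
    refine Finset.sum_congr rfl fun i _ ↦ ?_
    rw [integral_finsetSum _ fun j _ ↦ (h2 i j).integrable]
    exact Finset.sum_congr rfl fun j _ ↦ (integral_const_mul _ _).symm
  rw [h3, pairing, pairing, ← integral_add h1.integrable
    (IsCc.sum _ fun i _ ↦ IsCc.sum _ fun j _ ↦ h2 i j).integrable]
  congr 1 with l
  -- skewness of `D⁻¹ (v βᵀ - β vᵀ)` replaces `v αᵀ` by half of `v αᵀ - α vᵀ`
  have h4 := sum_wedge_mul_skew (ε := ε) (v l) (α l) (Q := fun i j ↦ crossInv v β i j l)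
    fun i j ↦ crossInv_skew v β i j l
  have h5 : ∑ i, ∑ j, ε i * ε j / 2 * (cross v α i j l * crossInv v β i j l)
      = ∑ i, ∑ j, ε i * ε j * (v l i * α l j * crossInv v β i j l) := by
    rw [← mul_right_inj' (two_ne_zero (α := ℝ)), ← h4, Finset.mul_sum]
    refine Finset.sum_congr rfl fun i _ ↦ ?_
    rw [Finset.mul_sum]
    refine Finset.sum_congr rfl fun j _ ↦ ?_
    simp only [cross]
    ring
  rw [h5, Finset.sum_comm]
  simp only [dotp, opH_apply, mul_add, Finset.sum_add_distrib, Finset.mul_sum]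
  congr 1
  exact Finset.sum_congr rfl fun i _ ↦ Finset.sum_congr rfl fun j _ ↦ by ring

theorem hasDerivAt_pairing_opH (hv : Continuous v) (hu : Continuous u) (hα : IsTestField α)
    (hχ : IsTestField χ) :
    HasDerivAt (fun s : ℝ ↦ pairing ε α (opH skewInv ε (v + s • u) χ))
      (∑ i, ∑ j, ε i * ε j / 2 * (skewForm (cross u α i j) (cross v χ i j)
        + skewForm (cross v α i j) (cross u χ i j))) 0 := by
  have h : (fun s : ℝ ↦ pairing ε α (opH skewInv ε (v + s • u) χ)) = fun s ↦
      pairing ε α (deriv χ) + ∑ i, ∑ j, ε i * ε j / 2 * (skewForm (cross v α i j) (cross v χ i j)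
        + s * (skewForm (cross u α i j) (cross v χ i j) + skewForm (cross v α i j) (cross u χ i j))
        + s ^ 2 * skewForm (cross u α i j) (cross u χ i j)) := by
    ext s
    rw [pairing_opH (hv.add (hu.const_smul s)) hα hχ]
    simp only [cross_add_smul_left]
    congr 1
    refine Finset.sum_congr rfl fun i _ ↦ Finset.sum_congr rfl fun j _ ↦ ?_
    rw [(hα.isCc_cross hv i j).skewForm_add_smul (hα.isCc_cross hu i j) (hχ.isCc_cross hv i j)
      (hχ.isCc_cross hu i j)]
  rw [h]
  exact (HasDerivAt.fun_sum fun i _ ↦ HasDerivAt.fun_sum fun j _ ↦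
    (hasDerivAt_quadratic _ _ _).const_mul _).const_add _

/-- The derivative of the bivector is `∫ ∑ ε_i ε_j u_i (α_j X_ij - χ_j A_ij)`, with the matrices
`A = D⁻¹ (v αᵀ - α vᵀ)` and `X = D⁻¹ (v χᵀ - χ vᵀ)`. -/
theorem sum_skewForm_cross (hv : Continuous v) (hu : Continuous u) (hα : IsTestField α)
    (hχ : IsTestField χ) :
    ∑ i, ∑ j, ε i * ε j / 2 * (skewForm (cross u α i j) (cross v χ i j)
        + skewForm (cross v α i j) (cross u χ i j))
      = ∫ l, ∑ i, ∑ j, ε i * ε j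
          * (u l i * (α l j * crossInv v χ i j l - χ l j * crossInv v α i j l)) := by
  have h1 : ∀ i j, IsCc fun l ↦ cross u α i j l * crossInv v χ i j l := fun i j ↦
    (hα.isCc_cross hu i j).mul_right (hχ.isCc_cross hv i j).continuous_skewInv
  have h2 : ∀ i j, IsCc fun l ↦ cross u χ i j l * crossInv v α i j l := fun i j ↦
    (hχ.isCc_cross hu i j).mul_right (hα.isCc_cross hv i j).continuous_skewInv
  have h3 : ∀ i j, IsCc fun l ↦ ε i * ε j / 2 * (cross u α i j l * crossInv v χ i j l
      - cross u χ i j l * crossInv v α i j l) := fun i j ↦ ((h1 i j).sub (h2 i j)).const_mul _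
  have h4 : ∑ i, ∑ j, ε i * ε j / 2 * (skewForm (cross u α i j) (cross v χ i j)
        + skewForm (cross v α i j) (cross u χ i j))
      = ∫ l, ∑ i, ∑ j, ε i * ε j / 2 * (cross u α i j l * crossInv v χ i j l
          - cross u χ i j l * crossInv v α i j l) := by
    rw [integral_finsetSum _ fun i _ ↦ (IsCc.sum _ fun j _ ↦ h3 i j).integrable]
    refine Finset.sum_congr rfl fun i _ ↦ ?_
    rw [integral_finsetSum _ fun j _ ↦ (h3 i j).integrable]
    refine Finset.sum_congr rfl fun j _ ↦ ?_
    rw [integral_const_mul, integral_sub (h1 i j).integrable (h2 i j).integrable,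
      (hα.isCc_cross hv i j).skewForm_swap (hχ.isCc_cross hu i j), ← sub_eq_add_neg]
    rfl
  rw [h4]
  congr 1 with l
  have h5 := sum_wedge_mul_skew (ε := ε) (u l) (α l) (Q := fun i j ↦ crossInv v χ i j l)
    fun i j ↦ crossInv_skew v χ i j l
  have h6 := sum_wedge_mul_skew (ε := ε) (u l) (χ l) (Q := fun i j ↦ crossInv v α i j l)
    fun i j ↦ crossInv_skew v α i j l
  rw [← mul_right_inj' (two_ne_zero (α := ℝ))]
  calc _ = ∑ i, ∑ j, ε i * ε j * ((u l i * α l j - u l j * α l i) * crossInv v χ i j l)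
      - ∑ i, ∑ j, ε i * ε j * ((u l i * χ l j - u l j * χ l i) * crossInv v α i j l) := by
        simp only [Finset.mul_sum, ← Finset.sum_sub_distrib, cross]
        exact Finset.sum_congr rfl fun i _ ↦ Finset.sum_congr rfl fun j _ ↦ by ring
    _ = _ := by
        rw [h5, h6]
        simp only [Finset.mul_sum, ← Finset.sum_sub_distrib]
        exact Finset.sum_congr rfl fun i _ ↦ Finset.sum_congr rfl fun j _ ↦ by ring

theorem IsInvariantCovector.isCc_crossInv (hε : ∀ i, ε i ≠ 0) (hα : IsInvariantCovector ε v α)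
    (hv : Continuous v) (i j : Fin k) : IsCc (crossInv v α i j) := by
  refine (hα.1.isCc_cross hv i j).skewInv_of_integral_eq_zero ?_
  refine (mul_eq_zero.1 ?_).resolve_left (hε i)
  rw [← hα.2 i j, ← integral_const_mul]
  congr 1 with l
  simp only [wedge, outer, Matrix.sub_apply, Matrix.of_apply, cross]
  ring

end Cosymplectic

/-! ### The Jacobi identity -/

section Jacobi

variable {k : ℕ} {ε : Fin k → ℝ} {v α β χ : ℝ → Fin k → ℝ}

theorem IsTestField.isCc_bivector_deriv {u : ℝ → Fin k → ℝ} (hv : Continuous v) (hu : Continuous u)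
    (hα : IsTestField α) (hχ : IsTestField χ) :
    IsCc fun l ↦ ∑ i, ∑ j, ε i * ε j
      * (u l i * (α l j * crossInv v χ i j l - χ l j * crossInv v α i j l)) :=
  IsCc.sum _ fun i _ ↦ IsCc.sum _ fun j _ ↦
    ((((hα.isCc_apply j).mul_right (hχ.isCc_cross hv i j).continuous_skewInv).sub
      ((hχ.isCc_apply j).mul_right (hα.isCc_cross hv i j).continuous_skewInv)).mul_left
        ((continuous_apply i).comp hu)).const_mul _

/-- The function
`∑ ε_i ε_j (β_i α_j X_ij + χ_i β_j A_ij + α_i χ_j B_ij) - ∑ ε_i ε_j ε_m A_ij B_jm X_mi`, with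
`A`, `B`, `X` the matrices `D⁻¹ (v αᵀ - α vᵀ)` and so on. Its derivative is the integrand of the
Jacobi identity. -/
def jacobiPotential (ε : Fin k → ℝ) (v α β χ : ℝ → Fin k → ℝ) (l : ℝ) : ℝ :=
  ∑ i, ∑ j, ε i * ε j * (β l i * α l j * crossInv v χ i j l + χ l i * β l j * crossInv v α i j l
      + α l i * χ l j * crossInv v β i j l)
    - ∑ i, ∑ j, ∑ m, ε i * ε j * ε m
      * (crossInv v α i j l * crossInv v β j m l * crossInv v χ m i l)

theorem hasDerivAt_jacobiPotential (hv : Continuous v) (hα : IsTestField α) (hβ : IsTestField β)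
    (hχ : IsTestField χ) (l : ℝ) :
    HasDerivAt (jacobiPotential ε v α β χ)
      (∑ i, ∑ j, ε i * ε j * (opH skewInv ε v β l i
          * (α l j * crossInv v χ i j l - χ l j * crossInv v α i j l))
        + ∑ i, ∑ j, ε i * ε j * (opH skewInv ε v χ l i
          * (β l j * crossInv v α i j l - α l j * crossInv v β i j l))
        + ∑ i, ∑ j, ε i * ε j * (opH skewInv ε v α l i
          * (χ l j * crossInv v β i j l - β l j * crossInv v χ i j l))) l := by
  have hQ : ∀ {w : ℝ → Fin k → ℝ}, IsTestField w → ∀ i j,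
      HasDerivAt (crossInv v w i j) (cross v w i j l) l := fun hw i j ↦
    (hw.isCc_cross hv i j).hasDerivAt_skewInv l
  simp only [opH_apply]
  rw [jacobi_integrand (v l) (α l) (β l) (χ l) (deriv α l) (deriv β l) (deriv χ l)
    (A := fun i j ↦ crossInv v α i j l) (B := fun i j ↦ crossInv v β i j l)
    (C := fun i j ↦ crossInv v χ i j l) (fun i j ↦ crossInv_skew v α i j l)
    (fun i j ↦ crossInv_skew v β i j l) (fun i j ↦ crossInv_skew v χ i j l)]
  refine HasDerivAt.sub (HasDerivAt.fun_sum fun i _ ↦ HasDerivAt.fun_sum fun j _ ↦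
      HasDerivAt.const_mul _ ?_)
    (HasDerivAt.fun_sum fun i _ ↦ HasDerivAt.fun_sum fun j _ ↦ HasDerivAt.fun_sum fun m _ ↦
      HasDerivAt.const_mul _ ?_)
  · exact ((((hβ.hasDerivAt_apply i l).mul (hα.hasDerivAt_apply j l)).mul (hQ hχ i j)).add
      (((hχ.hasDerivAt_apply i l).mul (hβ.hasDerivAt_apply j l)).mul (hQ hα i j))).add
      (((hα.hasDerivAt_apply i l).mul (hχ.hasDerivAt_apply j l)).mul (hQ hβ i j))
  · exact ((hQ hα i j).mul (hQ hβ j m)).mul (hQ hχ m i)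

/-- Rotation invariance of one of the covectors is what makes the cubic term of the potential
compactly supported. -/
theorem hasCompactSupport_jacobiPotential (hε : ∀ i, ε i ≠ 0) (hv : Continuous v)
    (hα : IsInvariantCovector ε v α) (hβ : IsTestField β) (hχ : IsTestField χ) :
    HasCompactSupport (jacobiPotential ε v α β χ) := by
  have hQ : ∀ {w : ℝ → Fin k → ℝ}, IsTestField w → ∀ i j, Continuous (crossInv v w i j) :=
    fun hw i j ↦ (hw.isCc_cross hv i j).continuous_skewInv
  have hw : ∀ {w : ℝ → Fin k → ℝ}, IsTestField w → ∀ i, Continuous fun l ↦ w l i :=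
    fun hw i ↦ (hw.isCc_apply i).1
  have hα' := hα.1
  refine (IsCc.sub (IsCc.sum _ fun i _ ↦ IsCc.sum _ fun j _ ↦ IsCc.const_mul ?_ _)
    (IsCc.sum _ fun i _ ↦ IsCc.sum _ fun j _ ↦ IsCc.sum _ fun m _ ↦ IsCc.const_mul ?_ _)).2
  · exact ((((hβ.isCc_apply i).mul_right (hw hα' j)).mul_right (hQ hχ i j)).add
      (((hχ.isCc_apply i).mul_right (hw hβ j)).mul_right (hQ hα' i j))).add
      (((hα'.isCc_apply i).mul_right (hw hχ j)).mul_right (hQ hβ i j))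
  · exact ((hα.isCc_crossInv hε hv i j).mul_right (hQ hβ j m)).mul_right (hQ hχ m i)

/-- The cyclic sum of the derivatives of the bivector is the integral of the derivative of
`jacobiPotential`. -/
theorem isCosymplecticOperator_opH (hε : ∀ i, ε i ≠ 0) :
    IsCosymplecticOperator ε (opH skewInv ε) := by
  intro v hv
  have hc := hv.continuous
  refine ⟨fun α hα ↦ hα.contDiff_opH hv, fun α β hα hβ ↦ ?_, fun α β χ hα hβ hχ ↦ ?_⟩
  · rw [pairing_opH hc hα hβ, pairing_opH hc hβ hα, hα.pairing_deriv hβ, neg_add,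
      ← Finset.sum_neg_distrib]
    simp only [← Finset.sum_neg_distrib]
    congr 1
    refine Finset.sum_congr rfl fun i _ ↦ Finset.sum_congr rfl fun j _ ↦ ?_
    rw [(hα.isCc_cross hc i j).skewForm_swap (hβ.isCc_cross hc i j), mul_neg]
  · have hH : ∀ {w}, IsTestField w → Continuous (opH skewInv ε v w) :=
      fun hw ↦ (hw.contDiff_opH hv).continuous
    refine ⟨_, _, _, hasDerivAt_pairing_opH hc (hH hβ.1) hα.1 hχ.1,
      hasDerivAt_pairing_opH hc (hH hχ.1) hβ.1 hα.1,
      hasDerivAt_pairing_opH hc (hH hα.1) hχ.1 hβ.1, ?_⟩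
    have h1 := hα.1.isCc_bivector_deriv (ε := ε) hc (hH hβ.1) hχ.1
    have h2 := hβ.1.isCc_bivector_deriv (ε := ε) hc (hH hχ.1) hα.1
    have h3 := hχ.1.isCc_bivector_deriv (ε := ε) hc (hH hα.1) hβ.1
    rw [sum_skewForm_cross hc (hH hβ.1) hα.1 hχ.1, sum_skewForm_cross hc (hH hχ.1) hβ.1 hα.1,
      sum_skewForm_cross hc (hH hα.1) hχ.1 hβ.1, ← integral_add h1.integrable h2.integrable,
      ← integral_add (h1.add h2).integrable h3.integrable]
    exact integral_eq_zero_of_hasDerivAt_of_isCc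
      (hasDerivAt_jacobiPotential hc hα.1 hβ.1 hχ.1)
      (hasCompactSupport_jacobiPotential hε hc hα hβ.1 hχ.1) ((h1.add h2).add h3).1

end Jacobi

/-! ### The lemma for both distributions -/

section Rank

variable {E : Type*} [NormedAddCommGroup E] [NormedSpace ℝ E] [FiniteDimensional ℝ E]
  {M : Type*} [TopologicalSpace M] [ChartedSpace E M] [IsManifold 𝓘(ℝ, E) ∞ M]

theorem NConnection.finrank_range_hproj {m : ℕ} (N : NConnection E M m) (x : M) :
    Module.finrank ℝ (LinearMap.range (N.hproj x).toLinearMap) + m = Module.finrank ℝ E := by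
  have : FiniteDimensional ℝ (TangentSpace 𝓘(ℝ, E) x) :=
    inferInstanceAs (FiniteDimensional ℝ E)
  have h : LinearMap.range (N.hproj x).toLinearMap = LinearMap.ker (N.vproj x).toLinearMap := by
    ext ξ
    constructor
    · rintro ⟨η, rfl⟩
      simp [NConnection.hproj, N.idem]
    · intro hξ
      have hξ' : N.vproj x ξ = 0 := hξ
      exact ⟨ξ, by simp [NConnection.hproj, hξ']⟩
  have := LinearMap.finrank_range_add_finrank_ker (N.vproj x).toLinearMap
  rw [N.rank_eq x, ← h, add_comm] at this
  exact this

end Rank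

end

theorem mainTheorem9
    {E : Type*} [NormedAddCommGroup E] [NormedSpace ℝ E] [FiniteDimensional ℝ E]
    {M : Type*} [TopologicalSpace M] [T2Space M] [ChartedSpace E M] [IsManifold 𝓘(ℝ, E) ∞ M]
    (p q : ℕ) (hdim : Module.finrank ℝ E = (p + 1) + (q + 1))
    (N : NConnection E M (q + 1)) (g : DMetric N) (D : DConnection g)
    (R S : ℝ)
    (hR : HasConstantCurvature D N.hproj R) (hS : HasConstantCurvature D N.vproj S)
    (T : Set ℝ) (hT : IsOpen T) (γ : ℝ × ℝ → M)
    (hγ : ContMDiffOn 𝓘(ℝ, ℝ × ℝ) 𝓘(ℝ, E) ∞ γ (T ×ˢ Set.univ))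
    (htors : ∀ r ∈ T ×ˢ (Set.univ : Set ℝ),
      D.cov.torsion (γ r) (tangentVec γ r) (flowVec γ r) = 0)
    (εh : Fin p → ℝ) (εv : Fin q → ℝ)
    (Fh : ParallelFrame D N.hproj γ T εh) (Fv : ParallelFrame D N.vproj γ T εv) :
    (SatisfiesStructureEqs T εh R Fh.data ∧ SatisfiesStructureEqs T εv S Fv.data) ∧
    (SatisfiesFlowEqs T εh R Fh.data ∧ SatisfiesFlowEqs T εv S Fv.data) ∧
    (IsSymplecticOperator εh (opJ skewInv εh) ∧ IsSymplecticOperator εv (opJ skewInv εv)) ∧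
    (IsCosymplecticOperator εh (opH skewInv εh) ∧
      IsCosymplecticOperator εv (opH skewInv εv)) := by
  have hrank : ∀ x : M,
      Module.finrank ℝ (LinearMap.range (N.hproj x).toLinearMap) = p + 1 := fun x ↦ by
    have := N.finrank_range_hproj x
    omega
  have hh := Fh.satisfiesStructureEqs (isParallelProjection_hproj D) hrank hR hT hγ htors
  have hv := Fv.satisfiesStructureEqs (isParallelProjection_vproj D) N.rank_eq hS hT hγ htors
  exact ⟨⟨hh, hv⟩, ⟨hh.satisfiesFlowEqs, hv.satisfiesFlowEqs⟩,
    ⟨isSymplecticOperator_opJ εh, isSymplecticOperator_opJ εv⟩,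
    isCosymplecticOperator_opH fun i ↦ (Fh.sign i).elim (fun h ↦ by simp [h]) fun h ↦ by simp [h],
    isCosymplecticOperator_opH fun i ↦ (Fv.sign i).elim (fun h ↦ by simp [h]) fun h ↦ by simp [h]⟩
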